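/- Let $x_1,x_2,\dots$ be commuting variables and $\theta_1,\theta_2,\dots$ anticommuting ones ($\theta_i\theta_j=-\theta_j\theta_i$, $\theta_i^2=0$, $x_i\theta_j=\theta_jx_i$). Let $\mathscr P^{S_\infty}$ be the $\mathbb Q$-algebra of symmetric superfunctions: formal series over $\mathbb Q$ in these variables, of bounded total degree, invariant under all simultaneous exchanges $x_i\leftrightarrow x_{i+1}$, $\theta_i\leftrightarrow\theta_{i+1}$. For $f\in\mathscr P^{S_\infty}$ let $\overleftarrow f$ be obtained by reversing the order of the $\theta$'s in every monomial, so that $\overleftarrow f=(-1)^{m(m-1)/2}f$ if $f$ is homogeneous of degree $m$ in $\theta$. Put $p_n=\sum_i x_i^n$ ($n\ge1$) and $\tilde p_n=\sum_i\theta_ix_i^n$ ($n\ge0$). A superpartition $\Lambda=(\Lambda^a;\Lambda^s)$ consists of a strictly decreasing finite sequence $\Lambda^a=(\Lambda_1>\dots>\Lambda_m\ge0)$ and a partition $\Lambda^s=(\Lambda_{m+1}\ge\dots\ge\Lambda_\ell>0)$, either of which may be empty. Put $p_\Lambda=\tilde p_{\Lambda_1}\cdots\tilde p_{\Lambda_m}\,p_{\Lambda_{m+1}}\cdots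 p_{\Lambda_\ell}$ and $z_\Lambda=\prod_{k\ge1}k^{n(k)}\,n(k)!$, where $n(k)$ is the number of parts of $\Lambda^s$ equal to $k$. For $n\ge0$ let $e_n$ be the sum of all squarefree monomials of degree $n$ in $x$, $h_n$ the sum of all monomials of degree $n$ in $x$, $\tilde e_n$ the sum of all $\theta_ix^\alpha$ with $x^\alpha$ squarefree of degree $n$ and $\alpha_i=0$, and $\tilde h_n=\sum_i\sum_{|\alpha|=n}(\alpha_i+1)\,\theta_ix^\alpha$. **Proposition.** There is a unique bilinear form $\langle\!\langle\,\cdot\,|\,\cdot\,\rangle\!\rangle:\mathscr P^{S_\infty}\times\mathscr P^{S_\infty}\to\mathbb Q$ with $\langle\!\langle\overleftarrow{p_\Lambda}|p_\Omega\rangle\!\rangle=z_\Lambda\,\delta_{\Lambda\Omega}$ for all superpartitions $\Lambda,\Omega$, and there is a unique $\mathbb Q$-algebra homomorphism $\hat\omega:\mathscr P^{S_\infty}\to\mathscr P^{S_\infty}$ with $\hat\omega(e_n)=h_n$ and $\hat\omega(\tilde e_n)=\tilde h_n$ for all $n\ge0$. For all $f,g\in\mathscr P^{S_\infty}$: 1.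 (symmetry) $\langle\!\langle\overleftarrow f|g\rangle\!\rangle=\langle\!\langle\overleftarrow g|f\rangle\!\rangle=\langle\!\langle g|\overleftarrow f\rangle\!\rangle$; 2. (positivity) $\langle\!\langle\overleftarrow f|f\rangle\!\rangle>0$ if $f\ne0$; 3. (isometry) $\hat\omega$ is an involution, $\hat\omega(\hat\omega f)=f$, and $\langle\!\langle\overleftarrow{\hat\omega f}|\hat\omega g\rangle\!\rangle=\langle\!\langle\overleftarrow f|g\rangle\!\rangle$. -/

import Mathlib

/-- Number of inversions between two sets of indices: for disjoint `K`, `L` one has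
`θ_K θ_L = (-1) ^ (inversions K L) θ_{K ∪ L}`, where `θ_J` is the product of the `θ_j`, `j ∈ J`,
in increasing order. -/
def inversions (K L : Finset ℕ) : ℕ := ((K ×ˢ L).filter fun q => q.2 < q.1).card

theorem inversions_union_left {K L : Finset ℕ} (M : Finset ℕ) (h : Disjoint K L) :
    inversions (K ∪ L) M = inversions K M + inversions L M := by
  unfold inversions
  rw [Finset.union_product, Finset.filter_union, Finset.card_union_of_disjoint]
  exact Finset.disjoint_filter_filter (Finset.disjoint_product.mpr (Or.inl h))

theorem inversions_union_right (K : Finset ℕ) {L M : Finset ℕ} (h : Disjoint L M) :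
    inversions K (L ∪ M) = inversions K L + inversions K M := by
  unfold inversions
  rw [Finset.product_union, Finset.filter_union, Finset.card_union_of_disjoint]
  exact Finset.disjoint_filter_filter (Finset.disjoint_product.mpr (Or.inr h))

/-- Formal Grassmann algebra in the anticommuting variables `θ_0, θ_1, …` over `R`:
`f` stands for the formal sum of the `f J • θ_J` over the finite sets `J` of indices. -/
def GrassmannSeries (R : Type*) : Type _ := Finset ℕ → R

namespace GrassmannSeries

@[ext] theorem ext {R : Type*} {f g : GrassmannSeries R} (h : ∀ J, f J = g J) : f = g := funext h

variable {R : Type*} [CommRing R]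

instance : AddCommGroup (GrassmannSeries R) := inferInstanceAs (AddCommGroup (Finset ℕ → R))

instance {S : Type*} [CommRing S] [Algebra S R] : Module S (GrassmannSeries R) :=
  inferInstanceAs (Module S (Finset ℕ → R))

instance : One (GrassmannSeries R) := ⟨fun J => if J = ∅ then 1 else 0⟩

instance : Mul (GrassmannSeries R) :=
  ⟨fun f g J => ∑ K ∈ J.powerset, (-1) ^ inversions K (J \ K) * (f K * g (J \ K))⟩

theorem add_apply (f g : GrassmannSeries R) (J : Finset ℕ) : (f + g) J = f J + g J := rfl

theorem zero_apply (J : Finset ℕ) : (0 : GrassmannSeries R) J = 0 := rfl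

theorem one_apply (J : Finset ℕ) : (1 : GrassmannSeries R) J = if J = ∅ then 1 else 0 := rfl

theorem smul_apply {S : Type*} [CommRing S] [Algebra S R] (c : S) (f : GrassmannSeries R)
    (J : Finset ℕ) : (c • f) J = c • f J := rfl

theorem mul_apply (f g : GrassmannSeries R) (J : Finset ℕ) :
    (f * g) J = ∑ K ∈ J.powerset, (-1) ^ inversions K (J \ K) * (f K * g (J \ K)) := rfl

theorem one_mul' (f : GrassmannSeries R) : 1 * f = f := by
  ext J
  rw [mul_apply, Finset.sum_eq_single ∅]
  · simp [one_apply, inversions]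
  · intro K _ hK
    simp [one_apply, hK]
  · simp

theorem mul_one' (f : GrassmannSeries R) : f * 1 = f := by
  ext J
  rw [mul_apply, Finset.sum_eq_single J]
  · simp [one_apply, inversions]
  · intro K hK hne
    have : J \ K ≠ ∅ := by
      intro h
      exact hne (Finset.Subset.antisymm (Finset.mem_powerset.mp hK)
        (Finset.sdiff_eq_empty_iff_subset.mp h))
    simp [one_apply, this]
  · simp

theorem mul_assoc' (f g h : GrassmannSeries R) : f * g * h = f * (g * h) := by
  ext J
  simp only [mul_apply, Finset.mul_sum, Finset.sum_mul]
  rw [Finset.sum_sigma', Finset.sum_sigma']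
  refine Finset.sum_bij' (fun q _ => ⟨q.2, q.1 \ q.2⟩) (fun q _ => ⟨q.1 ∪ q.2, q.1⟩) ?_ ?_ ?_ ?_ ?_
  · rintro ⟨M, K⟩ hq
    simp only [Finset.mem_sigma, Finset.mem_powerset] at hq ⊢
    exact ⟨hq.2.trans hq.1, Finset.sdiff_subset_sdiff hq.1 le_rfl⟩
  · rintro ⟨K, L⟩ hq
    simp only [Finset.mem_sigma, Finset.mem_powerset] at hq ⊢
    exact ⟨Finset.union_subset hq.1 (hq.2.trans Finset.sdiff_subset), Finset.subset_union_left⟩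
  · rintro ⟨M, K⟩ hq
    simp only [Finset.mem_sigma, Finset.mem_powerset] at hq
    simp [Finset.union_sdiff_of_subset hq.2]
  · rintro ⟨K, L⟩ hq
    simp only [Finset.mem_sigma, Finset.mem_powerset] at hq
    have : Disjoint K L := (Finset.disjoint_sdiff).mono_right hq.2
    simp [Finset.union_sdiff_cancel_left this]
  · rintro ⟨M, K⟩ hq
    simp only [Finset.mem_sigma, Finset.mem_powerset] at hq
    obtain ⟨hM, hK⟩ := hq
    have e1 : J \ K = (M \ K) ∪ (J \ M) := by
      ext a
      have := @hM a
      have := @hK a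
      simp only [Finset.mem_sdiff, Finset.mem_union]
      tauto
    have e2 : (J \ K) \ (M \ K) = J \ M := by
      ext a
      have := @hM a
      have := @hK a
      simp only [Finset.mem_sdiff]
      tauto
    have d1 : Disjoint (M \ K) (J \ M) :=
      (Finset.disjoint_sdiff (s := M) (t := J)).mono_left Finset.sdiff_subset
    have i1 : inversions M (J \ M) = inversions K (J \ M) + inversions (M \ K) (J \ M) := by
      rw [← inversions_union_left _ Finset.disjoint_sdiff, Finset.union_sdiff_of_subset hK]
    have i2 : inversions K (J \ K) = inversions K (M \ K) + inversions K (J \ M) := by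
      rw [e1, inversions_union_right _ d1]
    simp only [e2, i1, i2, pow_add]
    ring

instance : Ring (GrassmannSeries R) :=
  { (inferInstance : AddCommGroup (GrassmannSeries R)),
    (inferInstance : One (GrassmannSeries R)),
    (inferInstance : Mul (GrassmannSeries R)) with
    left_distrib := fun f g h => by
      ext J
      simp only [mul_apply, add_apply, mul_add, Finset.sum_add_distrib]
    right_distrib := fun f g h => by
      ext J
      simp only [mul_apply, add_apply, add_mul, mul_add, Finset.sum_add_distrib]
    zero_mul := fun f => by
      ext J
      simp [mul_apply, zero_apply]
    mul_zero := fun f => by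
      ext J
      simp [mul_apply, zero_apply]
    mul_assoc := mul_assoc'
    one_mul := one_mul'
    mul_one := mul_one' }

instance {S : Type*} [CommRing S] [Algebra S R] : Algebra S (GrassmannSeries R) :=
  Algebra.ofModule
    (fun c f g => by
      ext J
      simp only [mul_apply, smul_apply, Finset.smul_sum, smul_mul_assoc, mul_smul_comm])
    (fun c f g => by
      ext J
      simp only [mul_apply, smul_apply, Finset.smul_sum, mul_smul_comm])

/-- The even element `c`. -/
def even (c : R) : GrassmannSeries R := fun J => if J = ∅ then c else 0

/-- The odd element `∑ i, c i • θ_i`. -/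
def odd (c : ℕ → R) : GrassmannSeries R := fun J => ∑ i ∈ J, if J = {i} then c i else 0

/-- Reversal of the order of the anticommuting variables in every monomial: reversing a product
of `m` of them takes `m (m - 1) / 2` transpositions. -/
def reverse (f : GrassmannSeries R) : GrassmannSeries R :=
  fun J => (-1) ^ (J.card * (J.card - 1) / 2) * f J

end GrassmannSeries

/-- Formal series over `ℚ` in the commuting variables `x_0, x_1, …` and the anticommuting
variables `θ_0, θ_1, …`. -/
abbrev SuperSeries : Type := GrassmannSeries (MvPowerSeries ℕ ℚ)

namespace SuperSeries

/-- The exchange `(x_i, θ_i) ↔ (x_{i+1}, θ_{i+1})`. It sends `θ_L` to `θ_{s L}` with `s` the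
transposition of `i` and `i + 1`, up to a sign `-1` if `i` and `i + 1` are both in `L`. -/
noncomputable def exchange (i : ℕ) (f : SuperSeries) : SuperSeries := fun J =>
  (if i ∈ J ∧ i + 1 ∈ J then -1 else 1) *
    MvPowerSeries.renameEquiv ℚ (Equiv.swap i (i + 1))
      (f (J.map (Equiv.swap i (i + 1)).toEmbedding))

/-- The total degree in all the variables is bounded. -/
def BoundedDegree (f : SuperSeries) : Prop :=
  ∃ d : ℕ, ∀ (J : Finset ℕ) (α : ℕ →₀ ℕ),
    MvPowerSeries.coeff α (f J) ≠ 0 → J.card + α.degree ≤ d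


theorem inversions_swap (i : ℕ) {K L : Finset ℕ} (hKL : Disjoint K L) :
    inversions (K.map (Equiv.swap i (i + 1)).toEmbedding) (L.map (Equiv.swap i (i + 1)).toEmbedding)
      + (if i + 1 ∈ K ∧ i ∈ L then 1 else 0) =
    inversions K L + (if i ∈ K ∧ i + 1 ∈ L then 1 else 0) := by
  have key : ∀ a b : ℕ, (if (a, b) ∈ K ×ˢ L then 1 else 0) =
      ∑ q ∈ K ×ˢ L, if (a, b) = q then 1 else 0 := by
    intro a b
    rw [Finset.sum_ite_eq]
  have k1 := key (i + 1) i
  have k2 := key i (i + 1)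
  simp only [Finset.mem_product] at k1 k2
  rw [k1, k2]
  unfold inversions
  rw [Finset.card_filter, Finset.card_filter, Finset.sum_product, Finset.sum_product,
    Finset.sum_product, Finset.sum_product]
  simp only [Finset.sum_map, ← Finset.sum_add_distrib]
  refine Finset.sum_congr rfl fun k hk => Finset.sum_congr rfl fun l hl => ?_
  have hne : k ≠ l := fun h => Finset.disjoint_left.mp hKL hk (h ▸ hl)
  simp only [Equiv.coe_toEmbedding, Equiv.swap_apply_def, Prod.mk.injEq]
  split_ifs <;> omega

theorem sign_swap (i : ℕ) {K L : Finset ℕ} (hKL : Disjoint K L) :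
    (if i ∈ K ∪ L ∧ i + 1 ∈ K ∪ L then -1 else 1 : MvPowerSeries ℕ ℚ) *
      (-1) ^ inversions (K.map (Equiv.swap i (i + 1)).toEmbedding)
        (L.map (Equiv.swap i (i + 1)).toEmbedding) =
    (-1) ^ inversions K L * ((if i ∈ K ∧ i + 1 ∈ K then -1 else 1) *
      (if i ∈ L ∧ i + 1 ∈ L then -1 else 1)) := by
  have h := inversions_swap i hKL
  have h1 : i ∈ K → i ∉ L := fun h => Finset.disjoint_left.mp hKL h
  have h2 : i + 1 ∈ K → i + 1 ∉ L := fun h => Finset.disjoint_left.mp hKL h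
  simp only [Finset.mem_union]
  by_cases a : i ∈ K <;> by_cases b : i + 1 ∈ K <;> by_cases c : i ∈ L <;>
    by_cases d : i + 1 ∈ L <;> simp_all [pow_succ]
  all_goals simp [← h, pow_succ]

theorem exchange_apply (i : ℕ) (f : SuperSeries) (J : Finset ℕ) :
    exchange i f J = (if i ∈ J ∧ i + 1 ∈ J then -1 else 1) *
      MvPowerSeries.renameEquiv ℚ (Equiv.swap i (i + 1))
        (f (J.map (Equiv.swap i (i + 1)).toEmbedding)) := rfl

theorem exchange_mul (i : ℕ) (f g : SuperSeries) :
    exchange i (f * g) = exchange i f * exchange i g := by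
  ext1 J
  set s := Equiv.swap i (i + 1) with hs
  have hss : ∀ K : Finset ℕ, (K.map s.toEmbedding).map s.toEmbedding = K := by
    intro K
    rw [Finset.map_map]
    convert Finset.map_refl using 2
    ext x
    simp [hs]
  rw [exchange_apply, GrassmannSeries.mul_apply, GrassmannSeries.mul_apply, map_sum,
    Finset.mul_sum]
  refine Finset.sum_bij' (fun (K : Finset ℕ) _ => K.map s.toEmbedding)
    (fun (K : Finset ℕ) _ => K.map s.toEmbedding)
    ?_ ?_ ?_ ?_ ?_
  · intro K hK
    rw [Finset.mem_powerset] at hK ⊢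
    have := Finset.map_subset_map (f := s.toEmbedding) |>.mpr hK
    rwa [hss] at this
  · intro K hK
    rw [Finset.mem_powerset] at hK ⊢
    exact Finset.map_subset_map.mpr hK
  · intro K _
    exact hss K
  · intro K _
    exact hss K
  · intro K' hK'
    obtain ⟨K, rfl⟩ : ∃ K : Finset ℕ, K.map s.toEmbedding = K' := ⟨_, hss K'⟩
    rw [Finset.mem_powerset, Finset.map_subset_map] at hK'
    have e : J.map s.toEmbedding \ K.map s.toEmbedding = (J \ K).map s.toEmbedding := by
      ext x
      simp
    have hsign := sign_swap i (Finset.disjoint_sdiff (s := K) (t := J))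
    rw [Finset.union_sdiff_of_subset hK', ← hs] at hsign
    rw [hss, e, exchange_apply, exchange_apply, ← hs, map_mul, map_mul, map_pow, map_neg, map_one,
      ← mul_assoc, hsign]
    ring

theorem coeff_rename_swap (i : ℕ) (p : MvPowerSeries ℕ ℚ) (α : ℕ →₀ ℕ) :
    MvPowerSeries.coeff α (MvPowerSeries.renameEquiv ℚ (Equiv.swap i (i + 1)) p) =
      MvPowerSeries.coeff (α.mapDomain (Equiv.swap i (i + 1))) p := by
  have h := MvPowerSeries.coeff_embDomain_rename (Equiv.swap i (i + 1)).toEmbedding p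
    (α.mapDomain (Equiv.swap i (i + 1)))
  have e : (α.mapDomain (Equiv.swap i (i + 1))).embDomain (Equiv.swap i (i + 1)).toEmbedding =
      α := by
    rw [Finsupp.embDomain_eq_mapDomain, ← Finsupp.mapDomain_comp]
    convert Finsupp.mapDomain_id
    funext x
    simp
  rw [e] at h
  exact h

theorem exchange_add (i : ℕ) (f g : SuperSeries) :
    exchange i (f + g) = exchange i f + exchange i g := by
  ext1 J
  simp only [exchange_apply, GrassmannSeries.add_apply, map_add, mul_add]

theorem exchange_smul (i : ℕ) (c : ℚ) (f : SuperSeries) :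
    exchange i (c • f) = c • exchange i f := by
  ext1 J
  simp only [exchange_apply, GrassmannSeries.smul_apply, map_smul, mul_smul_comm]

theorem exchange_even (i : ℕ) (c : MvPowerSeries ℕ ℚ) :
    exchange i (GrassmannSeries.even c) =
      GrassmannSeries.even (MvPowerSeries.renameEquiv ℚ (Equiv.swap i (i + 1)) c) := by
  ext1 J
  by_cases h : J = ∅
  · simp [exchange_apply, GrassmannSeries.even, h]
  · simp [exchange_apply, GrassmannSeries.even, h]

theorem exchange_odd (i : ℕ) (c : ℕ → MvPowerSeries ℕ ℚ)
    (hc : ∀ j, MvPowerSeries.renameEquiv ℚ (Equiv.swap i (i + 1)) (c (Equiv.swap i (i + 1) j)) =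
      c j) :
    exchange i (GrassmannSeries.odd c) = GrassmannSeries.odd c := by
  ext1 J
  by_cases h : ∃ j, J = {j}
  · obtain ⟨j, rfl⟩ := h
    have h2 : ¬ (i = j ∧ i + 1 = j) := by omega
    simp only [exchange_apply, GrassmannSeries.odd, Finset.mem_singleton, Finset.map_singleton,
      Finset.sum_singleton, if_true, if_neg h2, Equiv.coe_toEmbedding, hc, one_mul]
  · have h1 : ∀ j, J ≠ {j} := fun j hj => h ⟨j, hj⟩
    have h2 : ∀ j, J.map (Equiv.swap i (i + 1)).toEmbedding ≠ {j} := by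
      intro j hj
      have hcard : J.card = 1 := by
        rw [← Finset.card_map (Equiv.swap i (i + 1)).toEmbedding, hj, Finset.card_singleton]
      exact h (Finset.card_eq_one.mp hcard)
    simp [exchange_apply, GrassmannSeries.odd, h1, h2]

theorem BoundedDegree.add {f g : SuperSeries} (hf : BoundedDegree f) (hg : BoundedDegree g) :
    BoundedDegree (f + g) := by
  obtain ⟨a, ha⟩ := hf
  obtain ⟨b, hb⟩ := hg
  refine ⟨max a b, fun J α h => ?_⟩
  by_cases h1 : MvPowerSeries.coeff α (f J) = 0
  · refine (hb J α fun h2 => h ?_).trans (le_max_right _ _)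
    rw [GrassmannSeries.add_apply, map_add, h1, h2, add_zero]
  · exact (ha J α h1).trans (le_max_left _ _)

theorem BoundedDegree.smul (c : ℚ) {f : SuperSeries} (hf : BoundedDegree f) :
    BoundedDegree (c • f) := by
  obtain ⟨a, ha⟩ := hf
  refine ⟨a, fun J α h => ha J α fun h1 => h ?_⟩
  rw [GrassmannSeries.smul_apply, map_smul, h1, smul_zero]

theorem BoundedDegree.mul {f g : SuperSeries} (hf : BoundedDegree f) (hg : BoundedDegree g) :
    BoundedDegree (f * g) := by
  obtain ⟨a, ha⟩ := hf
  obtain ⟨b, hb⟩ := hg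
  refine ⟨a + b, fun J α h => ?_⟩
  rw [GrassmannSeries.mul_apply, map_sum] at h
  obtain ⟨K, hK, hne⟩ := Finset.exists_ne_zero_of_sum_ne_zero h
  have hne' : MvPowerSeries.coeff α (f K * g (J \ K)) ≠ 0 := by
    intro h0
    apply hne
    rcases neg_one_pow_eq_or (MvPowerSeries ℕ ℚ) (inversions K (J \ K)) with h1 | h1 <;>
      simp [h1, h0]
  rw [MvPowerSeries.coeff_mul] at hne'
  obtain ⟨⟨β, γ⟩, hq, hne2⟩ := Finset.exists_ne_zero_of_sum_ne_zero hne'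
  have h1 := ha K β (left_ne_zero_of_mul hne2)
  have h2 := hb (J \ K) γ (right_ne_zero_of_mul hne2)
  rw [Finset.HasAntidiagonal.mem_antidiagonal] at hq
  simp only at hq
  have h3 := Finset.card_sdiff_add_card_eq_card (Finset.mem_powerset.mp hK)
  have h4 : α.degree = β.degree + γ.degree := by rw [← hq, map_add]
  omega

theorem boundedDegree_even {c : MvPowerSeries ℕ ℚ} (d : ℕ)
    (hc : ∀ α, MvPowerSeries.coeff α c ≠ 0 → α.degree ≤ d) :
    BoundedDegree (GrassmannSeries.even c) := by
  refine ⟨d, fun J α h => ?_⟩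
  by_cases hJ : J = ∅
  · subst hJ
    simpa using hc α (by simpa [GrassmannSeries.even] using h)
  · simp [GrassmannSeries.even, hJ] at h

theorem boundedDegree_odd {c : ℕ → MvPowerSeries ℕ ℚ} (d : ℕ)
    (hc : ∀ i α, MvPowerSeries.coeff α (c i) ≠ 0 → α.degree ≤ d) :
    BoundedDegree (GrassmannSeries.odd c) := by
  refine ⟨d + 1, fun J α h => ?_⟩
  rw [GrassmannSeries.odd, map_sum] at h
  obtain ⟨i, _, hne⟩ := Finset.exists_ne_zero_of_sum_ne_zero h
  by_cases hJ : J = {i}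
  · subst hJ
    have := hc i α (by simpa using hne)
    simp only [Finset.card_singleton]
    omega
  · simp [hJ] at hne

theorem one_eq_even : (1 : SuperSeries) = GrassmannSeries.even 1 := rfl

theorem boundedDegree_one : BoundedDegree 1 := by
  classical
  refine boundedDegree_even 0 fun α h => ?_
  by_contra h0
  apply h
  rw [MvPowerSeries.coeff_one, if_neg]
  rintro rfl
  simp at h0

theorem exchange_one (i : ℕ) : exchange i 1 = 1 := by
  rw [one_eq_even, exchange_even, map_one]

end SuperSeries

/-- The algebra of symmetric superfunctions over `ℚ` in infinitely many variables: the series of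
bounded degree that are invariant under the simultaneous exchanges of the `x` and the `θ`. -/
noncomputable def SymSuper : Subalgebra ℚ SuperSeries where
  carrier := {f | f.BoundedDegree ∧ ∀ i, f.exchange i = f}
  mul_mem' := fun {f g} hf hg =>
    ⟨hf.1.mul hg.1, fun i => by rw [SuperSeries.exchange_mul, hf.2, hg.2]⟩
  add_mem' := fun {f g} hf hg =>
    ⟨hf.1.add hg.1, fun i => by rw [SuperSeries.exchange_add, hf.2, hg.2]⟩
  algebraMap_mem' := fun c => by
    rw [Algebra.algebraMap_eq_smul_one]
    exact ⟨SuperSeries.boundedDegree_one.smul c, fun i => by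
      rw [SuperSeries.exchange_smul, SuperSeries.exchange_one]⟩

namespace SymSuper

/-- The order of the anticommuting variables reversed, as a map on symmetric superfunctions. -/
noncomputable def reverse : SymSuper →ₗ[ℚ] SymSuper where
  toFun f := ⟨GrassmannSeries.reverse f.1, by
    obtain ⟨⟨a, ha⟩, hs⟩ := f.2
    refine ⟨⟨a, fun J α h => ha J α fun h0 => h ?_⟩, fun i => ?_⟩
    · unfold GrassmannSeries.reverse
      rcases neg_one_pow_eq_or (MvPowerSeries ℕ ℚ) (J.card * (J.card - 1) / 2) with h1 | h1 <;>
        simp [h1, h0]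
    · have h1 : ∀ J, SuperSeries.exchange i f.1 J = f.1 J := fun J => by rw [hs i]
      ext1 J
      rw [SuperSeries.exchange_apply]
      unfold GrassmannSeries.reverse
      rw [← h1 J, SuperSeries.exchange_apply, Finset.card_map, map_mul, map_pow, map_neg, map_one,
        mul_left_comm]⟩
  map_add' f g := by
    apply Subtype.ext
    ext1 J
    exact mul_add _ _ _
  map_smul' c f := by
    apply Subtype.ext
    ext1 J
    exact mul_smul_comm c ((-1 : MvPowerSeries ℕ ℚ) ^ (J.card * (J.card - 1) / 2)) (f.1 J)

/-- The series `∑ α, c α • x^α`. -/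
def toSeries (c : (ℕ →₀ ℕ) → ℚ) : MvPowerSeries ℕ ℚ := c

theorem coeff_toSeries (c : (ℕ →₀ ℕ) → ℚ) (α : ℕ →₀ ℕ) :
    MvPowerSeries.coeff α (toSeries c) = c α := rfl

/-- The element `∑ α, c α • x^α`, for coefficients that are invariant under permutations of the
indices. -/
noncomputable def ofEven (c : (ℕ →₀ ℕ) → ℚ) (d : ℕ) (hd : ∀ α, c α ≠ 0 → α.degree ≤ d)
    (hs : ∀ (s : Equiv.Perm ℕ) α, c (α.mapDomain s) = c α) : SymSuper :=
  ⟨GrassmannSeries.even (toSeries c), SuperSeries.boundedDegree_even d hd,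
    fun i => by
      rw [SuperSeries.exchange_even]
      congr 1
      ext α
      rw [SuperSeries.coeff_rename_swap, coeff_toSeries, coeff_toSeries]
      exact hs _ α⟩

/-- The element `∑ i, ∑ α, c i α • θ_i x^α`, for coefficients `c i α` that are invariant under
simultaneous permutations of the index `i` and the exponent `α`. -/
noncomputable def ofOdd (c : ℕ → (ℕ →₀ ℕ) → ℚ) (d : ℕ) (hd : ∀ i α, c i α ≠ 0 → α.degree ≤ d)
    (hs : ∀ (s : Equiv.Perm ℕ) i α, c (s i) (α.mapDomain s) = c i α) : SymSuper :=
  ⟨GrassmannSeries.odd fun i => toSeries (c i), SuperSeries.boundedDegree_odd d hd,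
    fun i => SuperSeries.exchange_odd i _ fun j => by
      ext α
      rw [SuperSeries.coeff_rename_swap, coeff_toSeries, coeff_toSeries]
      exact hs _ j α⟩

theorem mapDomain_perm_apply (s : Equiv.Perm ℕ) (α : ℕ →₀ ℕ) (i : ℕ) :
    α.mapDomain s (s i) = α i := Finsupp.mapDomain_apply s.injective _ _

theorem forall_mapDomain_perm (s : Equiv.Perm ℕ) (α : ℕ →₀ ℕ) (P : ℕ → Prop) :
    (∀ i, P (α.mapDomain s i)) ↔ ∀ i, P (α i) := by
  rw [← s.forall_congr_right (q := fun i => P (α.mapDomain s i))]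
  simp only [mapDomain_perm_apply]

open Classical in
/-- Elementary symmetric function `e_n`: the sum of the squarefree monomials of degree `n`. -/
noncomputable def e (n : ℕ) : SymSuper :=
  ofEven (fun α => if α.degree = n ∧ ∀ j, α j ≤ 1 then 1 else 0) n
    (fun α h => by
      by_contra h0
      exact h (if_neg fun h1 => h0 h1.1.le))
    (fun s α => by
      simp only [Finsupp.degree_mapDomain, forall_mapDomain_perm s α (· ≤ 1)])

open Classical in
/-- Fermionic elementary symmetric function: the sum of the `θ_i x^α` with `x^α` squarefree of
degree `n` and without the variable `x_i`. -/
noncomputable def eTilde (n : ℕ) : SymSuper :=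
  ofOdd (fun i α => if α.degree = n ∧ α i = 0 ∧ ∀ j, α j ≤ 1 then 1 else 0) n
    (fun i α h => by
      by_contra h0
      exact h (if_neg fun h1 => h0 h1.1.le))
    (fun s i α => by
      simp only [Finsupp.degree_mapDomain, forall_mapDomain_perm s α (· ≤ 1),
        mapDomain_perm_apply])

/-- Complete symmetric function `h_n`: the sum of all the monomials of degree `n`. -/
noncomputable def h (n : ℕ) : SymSuper :=
  ofEven (fun α => if α.degree = n then 1 else 0) n
    (fun α h => by
      by_contra h0
      exact h (if_neg fun h1 => h0 h1.le))
    (fun s α => by simp only [Finsupp.degree_mapDomain])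

/-- Fermionic complete symmetric function: the sum of all the `(α_i + 1) • θ_i x^α` with `x^α` of
degree `n`. -/
noncomputable def hTilde (n : ℕ) : SymSuper :=
  ofOdd (fun i α => if α.degree = n then (α i : ℚ) + 1 else 0) n
    (fun i α h => by
      by_contra h0
      exact h (if_neg fun h1 => h0 h1.le))
    (fun s i α => by simp only [Finsupp.degree_mapDomain, mapDomain_perm_apply])

theorem exists_mapDomain_eq_single (s : Equiv.Perm ℕ) (α : ℕ →₀ ℕ) (n : ℕ) :
    (∃ i, α.mapDomain s = Finsupp.single i n) ↔ ∃ i, α = Finsupp.single i n := by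
  rw [← s.exists_congr_right (q := fun i => α.mapDomain s = Finsupp.single i n)]
  simp only [← Finsupp.mapDomain_single,
    (Finsupp.mapDomain_injective s.injective).eq_iff]

open Classical in
/-- Power sum `p_n = ∑ i, x_i ^ n` for `n ≥ 1`, with the convention `p_0 = 0`. -/
noncomputable def p (n : ℕ) : SymSuper :=
  ofEven (fun α => if 1 ≤ n ∧ ∃ i, α = Finsupp.single i n then 1 else 0) n
    (fun α h => by
      by_contra h0
      refine h (if_neg ?_)
      rintro ⟨_, i, rfl⟩
      simp at h0)
    (fun s α => by simp only [exists_mapDomain_eq_single])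

/-- Fermionic power sum `∑ i, θ_i x_i ^ n`. -/
noncomputable def pTilde (n : ℕ) : SymSuper :=
  ofOdd (fun i α => if α = Finsupp.single i n then 1 else 0) n
    (fun i α h => by
      by_contra h0
      refine h (if_neg ?_)
      rintro rfl
      simp at h0)
    (fun s i α => by
      simp only [← Finsupp.mapDomain_single, (Finsupp.mapDomain_injective s.injective).eq_iff])

end SymSuper

/-- A superpartition `(Λᵃ; Λˢ)`: a strictly decreasing sequence of nonnegative integers and a
partition, given by its nonzero parts in decreasing order. -/
@[ext] structure SuperPartition where
  anti : List ℕ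
  symm : List ℕ
  anti_sorted : anti.Pairwise (· > ·)
  symm_sorted : symm.Pairwise (· ≥ ·)
  symm_pos : ∀ k ∈ symm, 0 < k

namespace SuperPartition

/-- The power sum product `p_Λ`, fermionic factors first, from left to right. -/
noncomputable def p (Λ : SuperPartition) : SymSuper :=
  (Λ.anti.map SymSuper.pTilde).prod * (Λ.symm.map SymSuper.p).prod

/-- `z_Λ = ∏ k ^ n(k) * n(k)!`, where `n(k)` is the number of parts of `Λˢ` equal to `k`. -/
def z (Λ : SuperPartition) : ℕ :=
  ∏ k ∈ Λ.symm.toFinset, k ^ Λ.symm.count k * (Λ.symm.count k).factorial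

end SuperPartition

open Classical in
/-- `B` is a bilinear form with `⟨⟨reverse p_Λ | p_Ω⟩⟩ = z_Λ δ_{ΛΩ}`. -/
def IsPowerSumForm (B : LinearMap.BilinForm ℚ SymSuper) : Prop :=
  ∀ Λ Ω : SuperPartition,
    B (SymSuper.reverse Λ.p) Ω.p = if Λ = Ω then (Λ.z : ℚ) else 0

/-- `ω` is a homomorphism of algebras that sends the elementary to the complete functions. -/
def IsOmega (ω : SymSuper →ₐ[ℚ] SymSuper) : Prop :=
  ∀ n, ω (SymSuper.e n) = SymSuper.h n ∧ ω (SymSuper.eTilde n) = SymSuper.hTilde n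

/-! The products `p_Λ` form a basis of the algebra, and every object in the statement is diagonal in
it. Reversal multiplies `p_Λ` by `(-1)^(m(m-1)/2)`, where `m` is the number of fermionic parts. The
form has `z_Λ > 0` on the diagonal once one argument is reversed. The homomorphism multiplies `p_n`
by `(-1)^(n-1)` and `p̃_n` by `(-1)^n`, hence `p_Λ` by a sign. Symmetry, positivity (a sum of `z_Λ
c_Λ^2`), involution and isometry (signs squared) can then be read off, and uniqueness holds because
a basis determines linear data.

Linear independence is triangularity (`card_degree_of_coeff_powerProd_ne_zero`): a monomial of `p_Λ`
involves at most as many indices as `Λ` has parts, and with equality its exponents are exactly the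
parts of `Λ`. Such monomials do occur, since all contributions to them have one sign
(`coeff_powerProd_mul_pos`).

Spanning is a dimension count (`degreeLE_le_span`). By invariance an element is determined by one
coefficient per superpartition, as a repeated fermionic exponent forces the coefficient to vanish.
So in degree at most `d` the dimension is at most the number of superpartitions of size at most `d`,
and that many independent `p_Λ` are available.

The passage from `e, ẽ` to power sums rests on Newton identities (`succ_smul_h`, `hTilde_eq`,
`succ_smul_e`, `eTilde_eq`). Those for `e` and `h` differ only by the signs `(-1)^i`. Solved one way
they show that the diagonal map sends `e` to `h`, and solved the other way that any such
homomorphism is diagonal on power sums. -/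

/-! ### Even elements are central, odd elements anticommute -/

namespace GrassmannSeries

variable {R : Type*} [CommRing R]

theorem even_mul_apply (c : R) (f : GrassmannSeries R) (J : Finset ℕ) :
    (even c * f) J = c * f J := by
  rw [mul_apply, Finset.sum_eq_single ∅]
  · simp [even, inversions]
  · intro K _ hK
    simp [even, hK]
  · simp

theorem mul_even_apply (c : R) (f : GrassmannSeries R) (J : Finset ℕ) :
    (f * even c) J = c * f J := by
  rw [mul_apply, Finset.sum_eq_single J]
  · simp [even, inversions, mul_comm]
  · intro K hK hne
    have : J \ K ≠ ∅ := fun h => hne (Finset.Subset.antisymm (Finset.mem_powerset.mp hK)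
      (Finset.sdiff_eq_empty_iff_subset.mp h))
    simp [even, this]
  · simp

theorem commute_even (c : R) (f : GrassmannSeries R) : Commute (even c) f := by
  ext J
  rw [even_mul_apply, mul_even_apply]

theorem odd_singleton (c : ℕ → R) (j : ℕ) : odd c {j} = c j := by
  simp [odd]

theorem odd_eq_zero (c : ℕ → R) {J : Finset ℕ} (h : J.card ≠ 1) : odd c J = 0 := by
  unfold odd
  refine Finset.sum_eq_zero fun i _ => if_neg ?_
  rintro rfl
  simp at h

theorem odd_mul_apply (c : ℕ → R) (f : GrassmannSeries R) (J : Finset ℕ) :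
    (odd c * f) J =
      ∑ j ∈ J, (-1) ^ inversions {j} (J.erase j) * (c j * f (J.erase j)) := by
  rw [mul_apply]
  symm
  refine Finset.sum_of_injOn (fun j => {j}) ?_ ?_ ?_ ?_
  · intro a _ b _ h
    simpa using h
  · intro j hj
    simpa using hj
  · intro K _ hK
    rw [odd_eq_zero, zero_mul, mul_zero]
    intro h
    obtain ⟨j, rfl⟩ := Finset.card_eq_one.mp h
    simp_all
  · intro j _
    rw [odd_singleton, Finset.sdiff_singleton_eq_erase]

/-- Disjointness leaves no ties, so each pair is an inversion in exactly one of the two orders. -/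
theorem inversions_add_inversions {K L : Finset ℕ} (h : Disjoint K L) :
    inversions K L + inversions L K = K.card * L.card := by
  have e : inversions L K = ((K ×ˢ L).filter fun q => q.1 < q.2).card := by
    unfold inversions
    refine Finset.card_bij' (fun q _ => q.swap) (fun q _ => q.swap) ?_ ?_ ?_ ?_ <;>
      simp +contextual
  rw [e, inversions, ← Finset.card_union_of_disjoint, ← Finset.card_product, ← Finset.filter_or,
    Finset.filter_true_of_mem]
  · rintro ⟨a, b⟩ hq
    rw [Finset.mem_product] at hq
    have : a ≠ b := fun hab => Finset.disjoint_left.mp h hq.1 (hab ▸ hq.2)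
    simp only
    omega
  · refine Finset.disjoint_filter.mpr fun q _ h1 h2 => ?_
    omega

/-- The term of `K` in one product is matched with that of `J \ K` in the other. Only pairs of
singletons contribute, and for these the two inversion numbers add up to 1, so the signs are
opposite. -/
theorem odd_mul_odd (c d : ℕ → R) : odd c * odd d = -(odd d * odd c) := by
  rw [eq_neg_iff_add_eq_zero]
  ext J
  have h2 : (odd d * odd c) J = ∑ K ∈ J.powerset,
      (-1) ^ inversions (J \ K) K * (odd d (J \ K) * odd c K) := by
    rw [mul_apply]
    refine Finset.sum_bij' (fun K _ => J \ K) (fun K _ => J \ K) ?_ ?_ ?_ ?_ ?_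
    · simp
    · simp
    · intro K hK
      simpa using Finset.mem_powerset.mp hK
    · intro K hK
      simpa using Finset.mem_powerset.mp hK
    · intro K hK
      rw [Finset.sdiff_sdiff_eq_self (Finset.mem_powerset.mp hK)]
  rw [add_apply, zero_apply, h2, mul_apply, ← Finset.sum_add_distrib]
  refine Finset.sum_eq_zero fun K _ => ?_
  by_cases hK : K.card = 1
  · by_cases hL : (J \ K).card = 1
    · have h := inversions_add_inversions (Finset.disjoint_sdiff (s := K) (t := J))
      rw [hK, hL] at h
      have h' : inversions K (J \ K) = 0 ∧ inversions (J \ K) K = 1 ∨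
          inversions K (J \ K) = 1 ∧ inversions (J \ K) K = 0 := by omega
      rcases h' with ⟨h1, h2⟩ | ⟨h1, h2⟩ <;> rw [h1, h2] <;> ring
    · simp [odd_eq_zero _ hL]
  · simp [odd_eq_zero _ hK]

end GrassmannSeries

/-! ### Coefficients of products with a power sum -/

namespace SymSuper

/-- The coefficient of `θ_J x^α`. -/
noncomputable def coeff (J : Finset ℕ) (α : ℕ →₀ ℕ) : SymSuper →ₗ[ℚ] ℚ where
  toFun f := MvPowerSeries.coeff α (f.1 J)
  map_add' f g := by
    rw [Subalgebra.coe_add, GrassmannSeries.add_apply, map_add]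
  map_smul' c f := by
    rw [Subalgebra.coe_smul, GrassmannSeries.smul_apply, map_smul, RingHom.id_apply]

theorem coeff_apply (J : Finset ℕ) (α : ℕ →₀ ℕ) (f : SymSuper) :
    coeff J α f = MvPowerSeries.coeff α (f.1 J) := rfl

theorem ext_coeff {f g : SymSuper} (h : ∀ J α, coeff J α f = coeff J α g) : f = g := by
  apply Subtype.ext
  ext J α
  exact h J α

theorem val_ofOdd (c d hd hs) :
    (ofOdd c d hd hs).1 = GrassmannSeries.odd fun i => toSeries (c i) := rfl

theorem coeff_ofEven (c d hd hs) (J : Finset ℕ) (α : ℕ →₀ ℕ) :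
    coeff J α (ofEven c d hd hs) = if J = ∅ then c α else 0 := by
  rw [coeff_apply]
  by_cases h : J = ∅
  · simp [ofEven, GrassmannSeries.even, h, coeff_toSeries]
  · simp [ofEven, GrassmannSeries.even, h]

theorem coeff_ofOdd_singleton (c d hd hs) (j : ℕ) (α : ℕ →₀ ℕ) :
    coeff {j} α (ofOdd c d hd hs) = c j α := by
  rw [coeff_apply, val_ofOdd, GrassmannSeries.odd_singleton, coeff_toSeries]

theorem coeff_ofOdd_of_card_ne (c d hd hs) {J : Finset ℕ} (hJ : J.card ≠ 1) (α : ℕ →₀ ℕ) :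
    coeff J α (ofOdd c d hd hs) = 0 := by
  rw [coeff_apply, val_ofOdd, GrassmannSeries.odd_eq_zero _ hJ, map_zero]

open Classical in
theorem coeff_one (J : Finset ℕ) (α : ℕ →₀ ℕ) :
    coeff J α 1 = if J = ∅ ∧ α = 0 then 1 else 0 := by
  rw [coeff_apply, Subalgebra.coe_one, GrassmannSeries.one_apply]
  by_cases h : J = ∅
  · simp [h, MvPowerSeries.coeff_one]
  · simp [h]

/-- For positive `n`, `x_j^n` can divide `x^α` only if `j` lies in the support of `α`, so the
infinite sum `p n` acts on each coefficient through finitely many terms. -/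
theorem coeff_p_mul {n : ℕ} (hn : 0 < n) (f : SymSuper) (J : Finset ℕ) (α : ℕ →₀ ℕ) :
    coeff J α (p n * f) =
      ∑ j ∈ α.support, if n ≤ α j then coeff J (α - Finsupp.single j n) f else 0 := by
  classical
  have hp : (p n).1 = GrassmannSeries.even (toSeries fun α =>
      if 1 ≤ n ∧ ∃ i, α = Finsupp.single i n then 1 else 0) := by
    unfold p ofEven
    congr!
  have hj : ∀ j, (if n ≤ α j then coeff J (α - Finsupp.single j n) f else 0) =
      MvPowerSeries.coeff α (MvPowerSeries.monomial (Finsupp.single j n) 1 * f.1 J) := by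
    intro j
    rw [MvPowerSeries.coeff_monomial_mul, one_mul, coeff_apply]
    simp only [Finsupp.single_le_iff]
  rw [coeff_apply, Subalgebra.coe_mul, hp, GrassmannSeries.even_mul_apply,
    Finset.sum_congr rfl fun j _ => hj j, ← map_sum, ← Finset.sum_mul, MvPowerSeries.coeff_mul,
    MvPowerSeries.coeff_mul]
  refine Finset.sum_congr rfl fun q hq => ?_
  congr 1
  rw [coeff_toSeries, map_sum]
  simp only [MvPowerSeries.coeff_monomial]
  rw [Finset.HasAntidiagonal.mem_antidiagonal] at hq
  by_cases h : ∃ i, q.1 = Finsupp.single i n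
  · obtain ⟨i, hi⟩ := h
    rw [if_pos ⟨hn, i, hi⟩, Finset.sum_eq_single i, if_pos hi]
    · intro j _ hji
      refine if_neg fun h => hji ?_
      rw [hi, Finsupp.single_left_inj hn.ne'] at h
      exact h.symm
    · intro h
      rw [Finsupp.mem_support_iff, not_not, ← hq, hi] at h
      simp at h
      omega
  · rw [if_neg fun h' => h h'.2]
    exact (Finset.sum_eq_zero fun j _ => if_neg fun h' => h ⟨j, h'⟩).symm

/-- The factor `θ_j` must be one of those in `θ_J`, and the sign moves it from the front to its
place. Here `n = 0` is allowed, since the sum runs over `J`. -/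
theorem coeff_pTilde_mul (n : ℕ) (f : SymSuper) (J : Finset ℕ) (α : ℕ →₀ ℕ) :
    coeff J α (pTilde n * f) = ∑ j ∈ J, (-1) ^ inversions {j} (J.erase j) *
      if n ≤ α j then coeff (J.erase j) (α - Finsupp.single j n) f else 0 := by
  classical
  have hp : (pTilde n).1 = GrassmannSeries.odd fun j =>
      MvPowerSeries.monomial (Finsupp.single j n) 1 := by
    unfold pTilde ofOdd
    congr!
    ext α
    rw [coeff_toSeries, MvPowerSeries.coeff_monomial]
  rw [coeff_apply, Subalgebra.coe_mul, hp, GrassmannSeries.odd_mul_apply, map_sum]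
  refine Finset.sum_congr rfl fun j _ => ?_
  have h : ∀ g : MvPowerSeries ℕ ℚ, MvPowerSeries.coeff α
      ((-1) ^ inversions {j} (J.erase j) * g) =
        (-1) ^ inversions {j} (J.erase j) * MvPowerSeries.coeff α g := by
    intro g
    induction inversions {j} (J.erase j) with
    | zero => simp
    | succ k ih => rw [pow_succ', pow_succ', mul_assoc, mul_assoc, neg_one_mul, map_neg, ih,
        neg_one_mul]
  rw [h, MvPowerSeries.coeff_monomial_mul, one_mul, coeff_apply]
  simp only [Finsupp.single_le_iff]

theorem commute_p (n : ℕ) (f : SymSuper) : Commute (p n) f :=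
  Subtype.ext (GrassmannSeries.commute_even _ f.1).eq

theorem pTilde_mul_pTilde (m n : ℕ) : pTilde m * pTilde n = -(pTilde n * pTilde m) :=
  Subtype.ext (GrassmannSeries.odd_mul_odd _ _)

end SymSuper

/-! ### Newton identities for elementary and complete functions -/

namespace SymSuper

open Classical in
theorem coeff_e (n : ℕ) (J : Finset ℕ) (α : ℕ →₀ ℕ) :
    coeff J α (e n) = if J = ∅ then if α.degree = n ∧ ∀ j, α j ≤ 1 then 1 else 0 else 0 := by
  rw [e, coeff_ofEven]

theorem coeff_h (n : ℕ) (J : Finset ℕ) (α : ℕ →₀ ℕ) :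
    coeff J α (h n) = if J = ∅ then if α.degree = n then 1 else 0 else 0 := by
  rw [h, coeff_ofEven]

theorem degree_sub_single {α : ℕ →₀ ℕ} {j n : ℕ} (h : n ≤ α j) :
    (α - Finsupp.single j n).degree + n = α.degree := by
  have h1 := congrArg Finsupp.degree (tsub_add_cancel_of_le (Finsupp.single_le_iff.mpr h))
  rwa [map_add, Finsupp.degree_single] at h1

/-- Only `i = a` and `i = a - 1` satisfy the condition, with opposite signs; for `a = 0` they
coincide and nothing cancels. This produces the cancellation in the identities for `e` and `eTilde`.
-/
theorem sum_range_neg_one_pow_ite {N a : ℕ} (ha : a < N) :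
    (∑ i ∈ Finset.range N, (-1 : ℚ) ^ i * if i ≤ a ∧ a ≤ i + 1 then 1 else 0) =
      if a = 0 then 1 else 0 := by
  cases a with
  | zero =>
    rw [Finset.sum_eq_single 0]
    · simp
    · intro i _ hi
      simp [hi]
    · simp [ha.ne']
  | succ a =>
    rw [← Finset.sum_subset (s₁ := {a, a + 1}) (by intro i; simp; omega)]
    · rw [Finset.sum_pair (by omega)]
      simp [pow_succ]
    · intro i _ hi
      simp only [Finset.mem_insert, Finset.mem_singleton] at hi
      rw [if_neg (by omega), mul_zero]

theorem forall_sub_single_le_one (α : ℕ →₀ ℕ) (j n : ℕ) :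
    (∀ k, (α - Finsupp.single j n) k ≤ 1) ↔ α j ≤ n + 1 ∧ ∀ k, k ≠ j → α k ≤ 1 := by
  constructor
  · refine fun h => ⟨?_, fun k hk => ?_⟩
    · have := h j
      simp only [Finsupp.tsub_apply, Finsupp.single_eq_same] at this
      omega
    · simpa [Finsupp.single_eq_of_ne hk] using h k
  · rintro ⟨h1, h2⟩ k
    by_cases hk : k = j
    · subst hk
      simp only [Finsupp.tsub_apply, Finsupp.single_eq_same]
      omega
    · simpa [Finsupp.single_eq_of_ne hk] using h2 k hk

theorem ite_one_eq_mul {P Q R : Prop} {_ : Decidable P} {_ : Decidable Q} {_ : Decidable R}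
    (h : P ↔ Q ∧ R) :
    (if P then (1 : ℚ) else 0) = (if Q then 1 else 0) * if R then 1 else 0 := by
  by_cases hQ : Q <;> by_cases hR : R <;> simp [h, hQ, hR]

/-- From `x^α` of degree `n + 1` one can split off a positive power of `x_j` in `α j` ways, and
these numbers add up to the degree. -/
theorem succ_smul_h (n : ℕ) :
    ((n : ℚ) + 1) • h (n + 1) = ∑ i ∈ Finset.range (n + 1), p (i + 1) * h (n - i) := by
  refine ext_coeff fun J α => ?_
  rw [map_smul, map_sum]
  simp only [coeff_p_mul (Nat.add_one_pos _), coeff_h, smul_eq_mul]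
  by_cases hJ : J = ∅
  swap
  · simp [hJ]
  simp only [hJ, if_true]
  rw [Finset.sum_comm]
  by_cases hα : α.degree = n + 1
  · have h1 : ∀ j, (∑ i ∈ Finset.range (n + 1), if i + 1 ≤ α j then
        if (α - Finsupp.single j (i + 1)).degree = n - i then (1 : ℚ) else 0 else 0) = α j := by
      intro j
      have hle : α j ≤ n + 1 := hα ▸ Finsupp.le_degree j α
      have h2 : ∀ i ∈ Finset.range (n + 1), (if i + 1 ≤ α j then
          if (α - Finsupp.single j (i + 1)).degree = n - i then (1 : ℚ) else 0 else 0) =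
          if i < α j then 1 else 0 := by
        intro i _
        by_cases h3 : i + 1 ≤ α j
        · have := degree_sub_single h3
          rw [if_pos h3, if_pos (by omega), if_pos (by omega)]
        · rw [if_neg h3, if_neg (by omega)]
      rw [Finset.sum_congr rfl h2, ← Finset.sum_filter, Finset.sum_const, nsmul_eq_mul, mul_one]
      congr 1
      rw [show (Finset.range (n + 1)).filter (· < α j) = Finset.range (α j) by
        ext i; simp; omega, Finset.card_range]
    rw [Finset.sum_congr rfl fun j _ => h1 j, if_pos hα, mul_one, ← Nat.cast_sum,
      ← Finsupp.degree_apply, hα]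
    push_cast
    rfl
  · rw [if_neg hα, mul_zero]
    symm
    refine Finset.sum_eq_zero fun j _ => Finset.sum_eq_zero fun i hi => ?_
    rw [Finset.mem_range] at hi
    by_cases h3 : i + 1 ≤ α j
    · have := degree_sub_single h3
      rw [if_pos h3, if_neg (by omega)]
    · rw [if_neg h3]

/-- The power split off together with `θ_j` may be `0, …, α j`; this is where the weight `α j + 1`
comes from. -/
theorem hTilde_eq (n : ℕ) :
    hTilde n = ∑ i ∈ Finset.range (n + 1), pTilde i * h (n - i) := by
  refine ext_coeff fun J α => ?_
  rw [map_sum]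
  simp only [coeff_pTilde_mul, coeff_h]
  by_cases hJ : J.card = 1
  swap
  · rw [hTilde, coeff_ofOdd_of_card_ne _ _ _ _ hJ]
    symm
    refine Finset.sum_eq_zero fun i _ => Finset.sum_eq_zero fun j hj => ?_
    rw [if_neg (c := J.erase j = ∅), ite_self, mul_zero]
    rw [← Finset.card_eq_zero, Finset.card_erase_of_mem hj]
    have := Finset.card_pos.mpr ⟨j, hj⟩
    omega
  obtain ⟨j, rfl⟩ := Finset.card_eq_one.mp hJ
  rw [hTilde, coeff_ofOdd_singleton]
  simp only [Finset.sum_singleton, Finset.erase_singleton, if_true]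
  have hinv : inversions {j} ∅ = 0 := by simp [inversions]
  simp only [hinv, pow_zero, one_mul]
  by_cases hα : α.degree = n
  · have hle : α j ≤ n := hα ▸ Finsupp.le_degree j α
    have h2 : ∀ i ∈ Finset.range (n + 1), (if i ≤ α j then
        if (α - Finsupp.single j i).degree = n - i then (1 : ℚ) else 0 else 0) =
        if i < α j + 1 then 1 else 0 := by
      intro i _
      by_cases h3 : i ≤ α j
      · have := degree_sub_single h3
        rw [if_pos h3, if_pos (by omega), if_pos (by omega)]
      · rw [if_neg h3, if_neg (by omega)]
    rw [Finset.sum_congr rfl h2, ← Finset.sum_filter, Finset.sum_const, nsmul_eq_mul, mul_one,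
      show (Finset.range (n + 1)).filter (· < α j + 1) = Finset.range (α j + 1) by
        ext i; simp; omega, Finset.card_range, if_pos hα]
    push_cast
    rfl
  · rw [if_neg hα]
    symm
    refine Finset.sum_eq_zero fun i hi => ?_
    rw [Finset.mem_range] at hi
    by_cases h3 : i ≤ α j
    · have := degree_sub_single h3
      rw [if_pos h3, if_neg (by omega)]
    · rw [if_neg h3]

/-- After `x_j^(i+1)` is split off, a squarefree rest has exponent 0 or 1 at `j`. These two choices
have opposite signs and cancel unless `α j = 1`, where only the exponent 0 is possible. So each
variable of a squarefree monomial counts once, and other monomials cancel. -/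
theorem succ_smul_e (n : ℕ) :
    ((n : ℚ) + 1) • e (n + 1) =
      ∑ i ∈ Finset.range (n + 1), (-1 : ℚ) ^ i • (p (i + 1) * e (n - i)) := by
  classical
  refine ext_coeff fun J α => ?_
  rw [map_smul, map_sum]
  simp only [map_smul, coeff_p_mul (Nat.add_one_pos _), coeff_e, smul_eq_mul]
  by_cases hJ : J = ∅
  swap
  · simp [hJ]
  simp only [hJ, if_true, Finset.mul_sum]
  rw [Finset.sum_comm]
  by_cases hα : α.degree = n + 1
  · have h1 : ∀ j ∈ α.support, (∑ i ∈ Finset.range (n + 1), (-1 : ℚ) ^ i * if i + 1 ≤ α j then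
        if (α - Finsupp.single j (i + 1)).degree = n - i ∧
          ∀ k, (α - Finsupp.single j (i + 1)) k ≤ 1 then (1 : ℚ) else 0 else 0) =
        if ∀ k, α k ≤ 1 then (α j : ℚ) else 0 := by
      intro j hj
      have hpos : α j ≠ 0 := Finsupp.mem_support_iff.mp hj
      have hle : α j ≤ n + 1 := hα ▸ Finsupp.le_degree j α
      have h2 : ∀ i ∈ Finset.range (n + 1), ((-1 : ℚ) ^ i * if i + 1 ≤ α j then
        if (α - Finsupp.single j (i + 1)).degree = n - i ∧
          ∀ k, (α - Finsupp.single j (i + 1)) k ≤ 1 then (1 : ℚ) else 0 else 0) =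
          ((-1 : ℚ) ^ i * if i ≤ α j - 1 ∧ α j - 1 ≤ i + 1 then 1 else 0) *
            if ∀ k, k ≠ j → α k ≤ 1 then 1 else 0 := by
        intro i _
        rw [forall_sub_single_le_one]
        by_cases h3 : i + 1 ≤ α j
        · have h4 := degree_sub_single h3
          rw [mul_assoc, if_pos h3]
          congr 1
          refine ite_one_eq_mul ?_
          rw [← and_assoc]
          refine and_congr_left' ?_
          omega
        · rw [if_neg h3, if_neg (c := i ≤ α j - 1 ∧ _) (by omega)]
          simp
      -- The alternating sum is applied with `a = α j - 1`, a true subtraction because `j` is in the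
      -- support.
      rw [Finset.sum_congr rfl h2, ← Finset.sum_mul, sum_range_neg_one_pow_ite (by omega),
        ite_zero_mul_ite_zero, mul_one]
      by_cases h5 : ∀ k, α k ≤ 1
      · have h6 : α j = 1 := by
          have := h5 j
          omega
        rw [if_pos ⟨by omega, fun k _ => h5 k⟩, if_pos h5, h6, Nat.cast_one]
      · rw [if_neg h5, if_neg]
        rintro ⟨h6, h7⟩
        refine h5 fun k => ?_
        by_cases hk : k = j
        · subst hk
          omega
        · exact h7 k hk
    rw [Finset.sum_congr rfl h1]
    by_cases h5 : ∀ k, α k ≤ 1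
    · simp only [if_pos h5]
      rw [if_pos ⟨hα, h5⟩, ← Nat.cast_sum, ← Finsupp.degree_apply, hα]
      push_cast
      ring
    · simp [h5]
  · rw [if_neg fun h => hα h.1, mul_zero]
    symm
    refine Finset.sum_eq_zero fun j _ => Finset.sum_eq_zero fun i hi => ?_
    rw [Finset.mem_range] at hi
    by_cases h3 : i + 1 ≤ α j
    · have := degree_sub_single h3
      rw [if_pos h3, if_neg fun h => by omega, mul_zero]
    · rw [if_neg h3, mul_zero]

/-- The same cancellation, with split-off powers starting at 0: the terms survive only for `α j =
0`, which is the condition that `x_j` is absent. -/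
theorem eTilde_eq (n : ℕ) :
    eTilde n = ∑ i ∈ Finset.range (n + 1), (-1 : ℚ) ^ i • (pTilde i * e (n - i)) := by
  classical
  refine ext_coeff fun J α => ?_
  rw [map_sum]
  simp only [map_smul, coeff_pTilde_mul, coeff_e, smul_eq_mul]
  by_cases hJ : J.card = 1
  swap
  · rw [eTilde, coeff_ofOdd_of_card_ne _ _ _ _ hJ]
    symm
    refine Finset.sum_eq_zero fun i _ => mul_eq_zero_of_right _ (Finset.sum_eq_zero fun j hj => ?_)
    rw [if_neg (c := J.erase j = ∅), ite_self, mul_zero]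
    rw [← Finset.card_eq_zero, Finset.card_erase_of_mem hj]
    have := Finset.card_pos.mpr ⟨j, hj⟩
    omega
  obtain ⟨j, rfl⟩ := Finset.card_eq_one.mp hJ
  rw [eTilde, coeff_ofOdd_singleton]
  simp only [Finset.sum_singleton, Finset.erase_singleton, if_true]
  have hinv : inversions {j} ∅ = 0 := by simp [inversions]
  simp only [hinv, pow_zero, one_mul]
  by_cases hα : α.degree = n
  · have hle : α j ≤ n := hα ▸ Finsupp.le_degree j α
    have h2 : ∀ i ∈ Finset.range (n + 1), ((-1 : ℚ) ^ i * if i ≤ α j then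
        if (α - Finsupp.single j i).degree = n - i ∧
          ∀ k, (α - Finsupp.single j i) k ≤ 1 then (1 : ℚ) else 0 else 0) =
          ((-1 : ℚ) ^ i * if i ≤ α j ∧ α j ≤ i + 1 then 1 else 0) *
            if ∀ k, k ≠ j → α k ≤ 1 then 1 else 0 := by
      intro i _
      rw [forall_sub_single_le_one]
      by_cases h3 : i ≤ α j
      · have h4 := degree_sub_single h3
        rw [mul_assoc, if_pos h3]
        congr 1
        refine ite_one_eq_mul ?_
        rw [← and_assoc]
        refine and_congr_left' ?_
        omega
      · rw [if_neg h3, if_neg (c := i ≤ α j ∧ _) (by omega)]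
        simp
    rw [Finset.sum_congr rfl h2, ← Finset.sum_mul, sum_range_neg_one_pow_ite (by omega),
      ite_zero_mul_ite_zero, mul_one]
    refine if_congr ?_ rfl rfl
    constructor
    · rintro ⟨_, h0, h1⟩
      exact ⟨h0, fun k _ => h1 k⟩
    · rintro ⟨h0, h1⟩
      refine ⟨hα, h0, fun k => ?_⟩
      by_cases hk : k = j
      · rw [hk, h0]
        exact zero_le_one
      · exact h1 k hk
  · rw [if_neg fun h => hα h.1]
    symm
    refine Finset.sum_eq_zero fun i hi => ?_
    rw [Finset.mem_range] at hi
    by_cases h3 : i ≤ α j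
    · have := degree_sub_single h3
      rw [if_pos h3, if_neg fun h => by omega, mul_zero]
    · rw [if_neg h3, mul_zero]

theorem e_zero : e 0 = 1 := by
  classical
  refine ext_coeff fun J α => ?_
  rw [coeff_e, coeff_one]
  by_cases hJ : J = ∅ <;> by_cases hα : α = 0 <;> simp [hJ, hα, Finsupp.degree_eq_zero_iff]

theorem h_zero : h 0 = 1 := by
  classical
  refine ext_coeff fun J α => ?_
  rw [coeff_h, coeff_one, ite_and]
  by_cases hJ : J = ∅ <;> simp only [hJ, if_true, if_false]
  refine if_congr ?_ rfl rfl
  rw [Finsupp.degree_eq_zero_iff]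

end SymSuper

/-! ### Triangularity of power sum products -/

namespace SymSuper

/-- The monomial `θ_J x^α` has the exponents `a` at the indices in `J` and the nonzero exponents
`b` at the indices outside `J`. -/
def HasType (J : Finset ℕ) (α : ℕ →₀ ℕ) (a b : List ℕ) : Prop :=
  J.val.map α = a ∧ (α.support \ J).val.map α = b

theorem HasType.card {J : Finset ℕ} {α : ℕ →₀ ℕ} {a b : List ℕ} (h : HasType J α a b) :
    J.card = a.length := by
  have := congrArg Multiset.card h.1
  simpa using this

theorem HasType.card_union {J : Finset ℕ} {α : ℕ →₀ ℕ} {a b : List ℕ} (h : HasType J α a b) :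
    (J ∪ α.support).card = a.length + b.length := by
  have := congrArg Multiset.card h.2
  simp only [Multiset.card_map, Multiset.coe_card] at this
  rw [← Finset.union_sdiff_self_eq_union, Finset.card_union_of_disjoint Finset.disjoint_sdiff,
    h.card]
  exact congrArg _ this

theorem HasType.degree {J : Finset ℕ} {α : ℕ →₀ ℕ} {a b : List ℕ} (h : HasType J α a b) :
    α.degree = a.sum + b.sum := by
  have h1 : ∑ i ∈ J, α i = a.sum := by
    rw [← Multiset.sum_coe, ← h.1]
    rfl
  have h2 : ∑ i ∈ α.support \ J, α i = b.sum := by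
    rw [← Multiset.sum_coe, ← h.2]
    rfl
  rw [← h1, ← h2, ← Finset.sum_union Finset.disjoint_sdiff, Finset.union_sdiff_self_eq_union,
    Finsupp.degree_apply]
  refine Finset.sum_subset Finset.subset_union_right fun i _ hi => ?_
  simpa using hi

theorem sub_single_of_ne (α : ℕ →₀ ℕ) {j k : ℕ} (n : ℕ) (h : k ≠ j) :
    (α - Finsupp.single j n) k = α k := by
  simp [Finsupp.single_eq_of_ne h]

theorem sub_single_self (α : ℕ →₀ ℕ) (j n : ℕ) :
    (α - Finsupp.single j n) j = α j - n := by
  simp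

theorem map_sub_single {J : Finset ℕ} (α : ℕ →₀ ℕ) {j : ℕ} (n : ℕ) (hj : j ∉ J) :
    J.val.map (α - Finsupp.single j n) = J.val.map α :=
  Multiset.map_congr rfl fun _ hk => sub_single_of_ne α n (ne_of_mem_of_not_mem hk hj)

/-- Each index of `J` is used by exactly one factor, since `θ_j` cannot repeat, and its exponent is
the one of that factor. -/
theorem type_of_coeff_prod_pTilde_ne_zero (a : List ℕ) :
    ∀ (J : Finset ℕ) (α : ℕ →₀ ℕ), coeff J α (a.map pTilde).prod ≠ 0 →
      J.val.map α = a ∧ α.support ⊆ J := by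
  induction a with
  | nil =>
    intro J α h
    rw [List.map_nil, List.prod_nil, coeff_one] at h
    have h' : J = ∅ ∧ α = 0 := by
      by_contra h0
      exact h (if_neg h0)
    simp [h'.1, h'.2]
  | cons n a ih =>
    intro J α h
    rw [List.map_cons, List.prod_cons, coeff_pTilde_mul] at h
    obtain ⟨j, hj, h1⟩ := Finset.exists_ne_zero_of_sum_ne_zero h
    have h2 := right_ne_zero_of_mul h1
    rw [ite_ne_right_iff] at h2
    obtain ⟨hle, h2⟩ := h2
    obtain ⟨h3, h4⟩ := ih _ _ h2
    rw [map_sub_single α n (Finset.notMem_erase j J)] at h3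
    have h5 : α j = n := by
      have : j ∉ (α - Finsupp.single j n).support := fun h => Finset.notMem_erase j J (h4 h)
      rw [Finsupp.notMem_support_iff, sub_single_self] at this
      omega
    refine ⟨?_, fun k hk => ?_⟩
    · rw [← Finset.insert_erase hj, Finset.insert_val_of_notMem (Finset.notMem_erase j J),
        Multiset.map_cons, h3, h5]
      rfl
    · by_cases hkj : k = j
      · rwa [hkj]
      · refine Finset.mem_of_mem_erase (h4 ?_)
        rw [Finsupp.mem_support_iff] at hk ⊢
        rwa [sub_single_of_ne α n hkj]

/-- The exponents on `J` are distinct, so at each stage a single index can come from the first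
factor and no cancellation is possible. -/
theorem coeff_prod_pTilde_ne_zero (a : List ℕ) :
    a.Nodup → ∀ (J : Finset ℕ) (α : ℕ →₀ ℕ), J.val.map α = a → α.support ⊆ J →
      coeff J α (a.map pTilde).prod ≠ 0 := by
  induction a with
  | nil =>
    intro _ J α h1 h2
    have hJ : J = ∅ := by simpa using h1
    have hα : α = 0 := by
      rw [hJ, Finset.subset_empty] at h2
      simpa using h2
    rw [List.map_nil, List.prod_nil, coeff_one, if_pos ⟨hJ, hα⟩]
    exact one_ne_zero
  | cons n a ih =>
    intro hnd J α h1 h2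
    have hn : n ∈ J.val.map α := by
      rw [h1]
      simp
    obtain ⟨j, hj, hjn⟩ := Multiset.mem_map.mp hn
    have hnd' : (J.val.map α).Nodup := by
      rw [h1]
      exact Multiset.coe_nodup.mpr hnd
    rw [List.map_cons, List.prod_cons, coeff_pTilde_mul, Finset.sum_eq_single j]
    · rw [if_pos hjn.ge]
      refine mul_ne_zero (pow_ne_zero _ (by norm_num)) ?_
      refine ih (List.nodup_cons.mp hnd).2 _ _ ?_ fun k hk => ?_
      · rw [map_sub_single α n (Finset.notMem_erase j J)]
        rw [← Finset.insert_erase (Finset.mem_val.mp hj),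
          Finset.insert_val_of_notMem (Finset.notMem_erase j J), Multiset.map_cons, hjn,
          ← Multiset.cons_coe, Multiset.cons_inj_right] at h1
        exact h1
      · rw [Finsupp.mem_support_iff] at hk
        by_cases hkj : k = j
        · rw [hkj, sub_single_self, hjn] at hk
          simp at hk
        · rw [sub_single_of_ne α n hkj] at hk
          exact Finset.mem_erase.mpr ⟨hkj, h2 (Finsupp.mem_support_iff.mpr hk)⟩
    · intro i hi hij
      refine mul_eq_zero_of_right _ ?_
      by_contra h3
      rw [← ne_eq, ite_ne_right_iff] at h3
      obtain ⟨hle, h3⟩ := h3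
      obtain ⟨_, h5⟩ := type_of_coeff_prod_pTilde_ne_zero a _ _ h3
      have h6 : α i = n := by
        have : i ∉ (α - Finsupp.single i n).support := fun h => Finset.notMem_erase i J (h5 h)
        rw [Finsupp.notMem_support_iff, sub_single_self] at this
        omega
      exact hij (Multiset.inj_on_of_nodup_map hnd' i hi j hj (h6.trans hjn.symm))
    · exact fun h => absurd hj h

theorem sdiff_eq_insert {J : Finset ℕ} {α : ℕ →₀ ℕ} {j n : ℕ} (hn : 0 < n) (hj : j ∉ J)
    (hjn : α j = n) :
    α.support \ J = insert j ((α - Finsupp.single j n).support \ J) ∧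
      j ∉ (α - Finsupp.single j n).support \ J := by
  constructor
  · ext k
    by_cases hk : k = j
    · subst hk
      simp [hj, hjn, hn.ne']
    · simp only [Finset.mem_insert, hk, false_or, Finset.mem_sdiff, Finsupp.mem_support_iff,
        sub_single_of_ne α n hk]
  · simp [hjn]

theorem hasType_cons_iff {J : Finset ℕ} {α : ℕ →₀ ℕ} {j n : ℕ} (hn : 0 < n) (hj : j ∉ J)
    (hjn : α j = n) (a b : List ℕ) :
    HasType J α a (n :: b) ↔ HasType J (α - Finsupp.single j n) a b := by
  unfold HasType
  obtain ⟨h1, h2⟩ := sdiff_eq_insert hn hj hjn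
  rw [map_sub_single α n hj, h1, Finset.insert_val_of_notMem h2, Multiset.map_cons, hjn,
    ← Multiset.cons_coe, Multiset.cons_inj_right]
  refine and_congr_right' ?_
  rw [Multiset.map_congr rfl]
  intro k hk
  exact (sub_single_of_ne α n (ne_of_mem_of_not_mem hk h2)).symm

/-- The product of the power sums with indices `b` and the fermionic power sums with
indices `a`. -/
noncomputable def powerProd (a b : List ℕ) : SymSuper :=
  (b.map p).prod * (a.map pTilde).prod

theorem powerProd_nil (a : List ℕ) : powerProd a [] = (a.map pTilde).prod := by
  simp [powerProd]

theorem powerProd_cons (a b : List ℕ) (n : ℕ) :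
    powerProd a (n :: b) = p n * powerProd a b := by
  simp [powerProd, mul_assoc]

/-- Every factor involves one index. The number of indices therefore attains the number of factors
only if no two factors share an index, and then the exponents are the given ones. -/
theorem card_degree_of_coeff_powerProd_ne_zero (a b : List ℕ) (hb : ∀ k ∈ b, 0 < k)
    (J : Finset ℕ) : ∀ α : ℕ →₀ ℕ, coeff J α (powerProd a b) ≠ 0 →
      J.card = a.length ∧ α.degree = a.sum + b.sum ∧
        (J ∪ α.support).card ≤ a.length + b.length ∧
          ((J ∪ α.support).card = a.length + b.length → HasType J α a b) := by
  induction b with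
  | nil =>
    intro α h
    rw [powerProd_nil] at h
    obtain ⟨h1, h2⟩ := type_of_coeff_prod_pTilde_ne_zero a J α h
    have h3 : HasType J α a [] := by
      refine ⟨h1, ?_⟩
      rw [Finset.sdiff_eq_empty_iff_subset.mpr h2]
      rfl
    exact ⟨h3.card, h3.degree, h3.card_union.le, fun _ => h3⟩
  | cons n b ih =>
    intro α h
    have hn : 0 < n := hb n (by simp)
    rw [powerProd_cons, coeff_p_mul hn] at h
    obtain ⟨j, hj, h1⟩ := Finset.exists_ne_zero_of_sum_ne_zero h
    rw [ite_ne_right_iff] at h1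
    obtain ⟨hle, h1⟩ := h1
    obtain ⟨i1, i2, i3, i4⟩ := ih (fun k hk => hb k (by simp [hk])) _ h1
    have hd := degree_sub_single hle
    have hsub : J ∪ α.support ⊆ insert j (J ∪ (α - Finsupp.single j n).support) := by
      intro k hk
      by_cases hkj : k = j
      · simp [hkj]
      · rw [Finset.mem_insert, Finset.mem_union, Finsupp.mem_support_iff,
          sub_single_of_ne α n hkj, ← Finsupp.mem_support_iff, ← Finset.mem_union]
        exact Or.inr hk
    have hc := Finset.card_le_card hsub
    have hc' := Finset.card_insert_le j (J ∪ (α - Finsupp.single j n).support)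
    simp only [List.sum_cons, List.length_cons]
    refine ⟨i1, by omega, by omega, fun heq => ?_⟩
    have hmem : j ∉ J ∪ (α - Finsupp.single j n).support := by
      intro hmem
      rw [Finset.insert_eq_of_mem hmem] at hc
      omega
    rw [Finset.mem_union, not_or, Finsupp.notMem_support_iff, sub_single_self] at hmem
    rw [hasType_cons_iff hn hmem.1 (by omega)]
    exact i4 (by omega)

theorem filter_sub_single {J : Finset ℕ} (α : ℕ →₀ ℕ) {j : ℕ} (n : ℕ) (hj : j ∉ J) :
    (α - Finsupp.single j n).filter (· ∈ J) = α.filter (· ∈ J) := by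
  ext k
  by_cases hk : k ∈ J
  · rw [Finsupp.filter_apply_pos _ _ hk, Finsupp.filter_apply_pos _ _ hk,
      sub_single_of_ne α n (ne_of_mem_of_not_mem hk hj)]
  · rw [Finsupp.filter_apply_neg _ _ hk, Finsupp.filter_apply_neg _ _ hk]

/-- For a monomial of the full type, the even factors act only on indices outside `J`. All
contributions thus carry the sign of the purely fermionic coefficient at `α` restricted to `J`;
multiplying by that coefficient makes them positive without naming the sign. -/
theorem coeff_powerProd_mul_pos (a b : List ℕ) (ha : a.Nodup) (hb : ∀ k ∈ b, 0 < k)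
    (J : Finset ℕ) : ∀ α : ℕ →₀ ℕ, HasType J α a b →
      0 < coeff J α (powerProd a b) * coeff J (α.filter (· ∈ J)) (powerProd a []) := by
  induction b with
  | nil =>
    intro α h
    have h2 : α.support ⊆ J := by
      rw [← Finset.sdiff_eq_empty_iff_subset, ← Finset.val_eq_zero, ← Multiset.map_eq_zero, h.2]
      rfl
    have h3 : α.filter (· ∈ J) = α :=
      (Finsupp.filter_eq_self_iff _ _).mpr fun k hk => h2 (Finsupp.mem_support_iff.mpr hk)
    rw [h3, powerProd_nil]
    exact mul_self_pos.mpr (coeff_prod_pTilde_ne_zero a ha J α h.1 h2)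
  | cons n b ih =>
    intro α h
    have hn : 0 < n := hb n (by simp)
    have hb' : ∀ k ∈ b, 0 < k := fun k hk => hb k (by simp [hk])
    rw [powerProd_cons, coeff_p_mul hn, Finset.sum_mul]
    have hpos : ∀ j ∈ α.support, j ∉ J → α j = n → 0 <
        (if n ≤ α j then coeff J (α - Finsupp.single j n) (powerProd a b) else 0) *
          coeff J (α.filter (· ∈ J)) (powerProd a []) := by
      intro j _ hjJ hjn
      rw [if_pos hjn.ge, ← filter_sub_single α n hjJ]
      exact ih hb' _ ((hasType_cons_iff hn hjJ hjn a b).mp h)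
    refine Finset.sum_pos' (fun j hj => ?_) ?_
    · by_cases h0 : (if n ≤ α j then coeff J (α - Finsupp.single j n) (powerProd a b) else 0) = 0
      · rw [h0, zero_mul]
      · have h0' := h0
        rw [← ne_eq, ite_ne_right_iff] at h0'
        obtain ⟨hle, h1⟩ := h0'
        obtain ⟨_, _, i3, i4⟩ := card_degree_of_coeff_powerProd_ne_zero a b hb' J _ h1
        have hc := h.card_union
        rw [List.length_cons] at hc
        -- If `j` still occurred after the removal, the remaining monomial would involve one index
        -- more than `powerProd a b` has factors.
        have hmem : j ∉ J ∪ (α - Finsupp.single j n).support := by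
          intro hmem
          have hsub : J ∪ α.support ⊆ J ∪ (α - Finsupp.single j n).support := by
            intro k hk
            by_cases hkj : k = j
            · rwa [hkj]
            · rwa [Finset.mem_union, Finsupp.mem_support_iff,
                sub_single_of_ne α n hkj, ← Finsupp.mem_support_iff, ← Finset.mem_union]
          have := Finset.card_le_card hsub
          omega
        rw [Finset.mem_union, not_or, Finsupp.notMem_support_iff, sub_single_self] at hmem
        exact (hpos j hj hmem.1 (by omega)).le
    · have hmem : n ∈ (α.support \ J).val.map α := by
        rw [h.2]
        simp
      obtain ⟨j, hj, hjn⟩ := Multiset.mem_map.mp hmem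
      rw [Finset.mem_val, Finset.mem_sdiff] at hj
      exact ⟨j, hj.1, hpos j hj.1 hj.2 hjn⟩

theorem commute_prod_p (b : List ℕ) (f : SymSuper) : Commute (b.map p).prod f := by
  induction b with
  | nil => exact Commute.one_left f
  | cons n b ih =>
    rw [List.map_cons, List.prod_cons]
    exact (commute_p n f).mul_left ih

end SymSuper

/-! ### Linear independence of the power sum products -/

namespace SuperPartition

open SymSuper

theorem p_eq_powerProd (Λ : SuperPartition) : Λ.p = powerProd Λ.anti Λ.symm :=
  (commute_prod_p _ _).symm

theorem nodup_anti (Λ : SuperPartition) : Λ.anti.Nodup :=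
  Λ.anti_sorted.imp fun h => h.ne'

theorem coeff_p_ne_zero {Λ : SuperPartition} {J : Finset ℕ} {α : ℕ →₀ ℕ}
    (h : HasType J α Λ.anti Λ.symm) : coeff J α Λ.p ≠ 0 := by
  rw [p_eq_powerProd]
  exact left_ne_zero_of_mul
    (coeff_powerProd_mul_pos _ _ Λ.nodup_anti Λ.symm_pos J α h).ne'

/-- A monomial determines both lists as multisets, and a sorted list is determined by its multiset.
-/
theorem eq_of_hasType {Λ Ω : SuperPartition} {J : Finset ℕ} {α : ℕ →₀ ℕ}
    (h : HasType J α Λ.anti Λ.symm) (h' : HasType J α Ω.anti Ω.symm) : Λ = Ω := by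
  ext1
  · exact (Multiset.coe_eq_coe.mp (h.1.symm.trans h'.1)).eq_of_pairwise
      (fun a b _ _ h1 h2 => absurd h1 (lt_asymm h2)) Λ.anti_sorted Ω.anti_sorted
  · exact (Multiset.coe_eq_coe.mp (h.2.symm.trans h'.2)).eq_of_pairwise
      (fun a b _ _ h1 h2 => le_antisymm h2 h1) Λ.symm_sorted Ω.symm_sorted

/-- In a relation, choose `Λ` with the most parts. At a monomial of type `Λ` another `p_Ω` could
contribute only with at least as many parts, hence equally many, and triangularity then gives `Ω =
Λ`. -/
theorem linearIndependent_p (hex : ∀ Λ : SuperPartition,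
    ∃ J α, HasType J α Λ.anti Λ.symm) : LinearIndependent ℚ p := by
  rw [linearIndependent_iff]
  intro l hl
  by_contra hne
  obtain ⟨Λ, hΛ, hmax⟩ := l.support.exists_max_image
    (fun Ω => Ω.anti.length + Ω.symm.length) (Finsupp.support_nonempty_iff.mpr hne)
  obtain ⟨J, α, hT⟩ := hex Λ
  have h := congrArg (coeff J α) hl
  rw [Finsupp.linearCombination_apply, Finsupp.sum, map_sum, map_zero,
    Finset.sum_eq_single Λ, map_smul, smul_eq_mul, mul_eq_zero] at h
  · exact h.elim (Finsupp.mem_support_iff.mp hΛ) (coeff_p_ne_zero hT)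
  · intro Ω hΩ hΩΛ
    rw [map_smul, smul_eq_mul]
    refine mul_eq_zero_of_right _ ?_
    by_contra h0
    rw [p_eq_powerProd] at h0
    obtain ⟨_, _, h3, h4⟩ :=
      card_degree_of_coeff_powerProd_ne_zero _ _ Ω.symm_pos J α h0
    have := hT.card_union
    have := hmax Ω hΩ
    exact hΩΛ (eq_of_hasType (h4 (by omega)) hT)
  · exact fun h => absurd hΛ h

end SuperPartition

/-! ### Monomials as lists, and invariance under exchanges -/

namespace SymSuper

theorem coeff_eq_exchange (f : SymSuper) (i : ℕ) (J : Finset ℕ) (α : ℕ →₀ ℕ) :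
    coeff J α f = (if i ∈ J ∧ i + 1 ∈ J then -1 else 1) *
      coeff (J.map (Equiv.swap i (i + 1)).toEmbedding)
        (α.mapDomain (Equiv.swap i (i + 1))) f := by
  have h := congrArg (fun g : SuperSeries => MvPowerSeries.coeff α (g J)) (f.2.2 i)
  simp only [SuperSeries.exchange_apply] at h
  rw [coeff_apply, coeff_apply, ← SuperSeries.coeff_rename_swap, ← h]
  split_ifs <;> simp

/-- The set `J` of the monomial `θ_J x^α` in which the index `i` occurs in `J` if the first
component of the `i`-th entry is true, and the exponent `α_i` is the second component. -/
def monSet (l : List (Bool × ℕ)) : Finset ℕ :=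
  (Finset.range l.length).filter fun i => (l.getD i (false, 0)).1 = true

/-- The exponent `α` of the monomial `θ_J x^α` given by a list of pairs. -/
noncomputable def monExp (l : List (Bool × ℕ)) : ℕ →₀ ℕ :=
  Finsupp.onFinset (Finset.range l.length) (fun i => (l.getD i (false, 0)).2) fun i h => by
    by_contra h0
    rw [Finset.mem_range, not_lt] at h0
    exact h (by rw [List.getD_eq_default _ _ h0])

theorem mem_monSet (l : List (Bool × ℕ)) (i : ℕ) :
    i ∈ monSet l ↔ (l.getD i (false, 0)).1 = true := by
  rw [monSet, Finset.mem_filter, Finset.mem_range, and_iff_right_iff_imp]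
  intro h
  by_contra h0
  rw [List.getD_eq_default _ _ (not_lt.mp h0)] at h
  exact Bool.false_ne_true h

theorem monExp_apply (l : List (Bool × ℕ)) (i : ℕ) :
    monExp l i = (l.getD i (false, 0)).2 := rfl

theorem getD_swap {A : Type*} (pre l : List A) (a b d : A) (k : ℕ) :
    (pre ++ b :: a :: l).getD k d =
      (pre ++ a :: b :: l).getD (Equiv.swap pre.length (pre.length + 1) k) d := by
  rcases lt_or_ge k pre.length with h | h
  · rw [Equiv.swap_apply_of_ne_of_ne (by omega) (by omega), List.getD_append _ _ _ _ h,
      List.getD_append _ _ _ _ h]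
  · obtain ⟨m, rfl⟩ := Nat.exists_eq_add_of_le h
    match m with
    | 0 => simp
    | 1 => simp
    | m + 2 =>
      rw [Equiv.swap_apply_of_ne_of_ne (by omega) (by omega),
        List.getD_append_right _ _ _ _ (by omega), List.getD_append_right _ _ _ _ (by omega)]
      simp

theorem monSet_swap (pre l : List (Bool × ℕ)) (a b : Bool × ℕ) :
    (monSet (pre ++ a :: b :: l)).map
      (Equiv.swap pre.length (pre.length + 1)).toEmbedding = monSet (pre ++ b :: a :: l) := by
  ext k
  rw [Finset.mem_map_equiv, mem_monSet, mem_monSet, getD_swap pre l a b, Equiv.symm_swap]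

theorem monExp_swap (pre l : List (Bool × ℕ)) (a b : Bool × ℕ) :
    (monExp (pre ++ a :: b :: l)).mapDomain (Equiv.swap pre.length (pre.length + 1)) =
      monExp (pre ++ b :: a :: l) := by
  ext k
  rw [← Finsupp.equivMapDomain_eq_mapDomain, Finsupp.equivMapDomain_apply, monExp_apply,
    monExp_apply, getD_swap pre l a b, Equiv.symm_swap]

theorem coeff_mon_swap (f : SymSuper) (pre l : List (Bool × ℕ)) (a b : Bool × ℕ) :
    coeff (monSet (pre ++ a :: b :: l)) (monExp (pre ++ a :: b :: l)) f =
      (if a.1 = true ∧ b.1 = true then -1 else 1) *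
        coeff (monSet (pre ++ b :: a :: l)) (monExp (pre ++ b :: a :: l)) f := by
  rw [coeff_eq_exchange f pre.length, monSet_swap, monExp_swap]
  simp [mem_monSet]

/-- Adjacent exchanges change a coefficient at most by a sign, and only its vanishing is recorded.
The arbitrary prefix lets the induction pass under a list head. -/
theorem coeff_mon_perm (f : SymSuper) {l l' : List (Bool × ℕ)} (h : l.Perm l') :
    ∀ pre : List (Bool × ℕ), coeff (monSet (pre ++ l)) (monExp (pre ++ l)) f = 0 ↔
      coeff (monSet (pre ++ l')) (monExp (pre ++ l')) f = 0 := by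
  induction h with
  | nil => exact fun _ => Iff.rfl
  | cons a _ ih =>
    intro pre
    simpa using ih (pre ++ [a])
  | swap a b l =>
    intro pre
    rw [coeff_mon_swap f pre l b a]
    split_ifs <;> simp
  | trans _ _ ih1 ih2 => exact fun pre => (ih1 pre).trans (ih2 pre)

/-- Once the two equal fermionic entries are moved to the front, exchanging them fixes the monomial
and negates the coefficient. -/
theorem coeff_mon_eq_zero_of_duplicate (f : SymSuper) {l : List (Bool × ℕ)} (n : ℕ)
    (h : List.Duplicate (true, n) l) : coeff (monSet l) (monExp l) f = 0 := by
  obtain ⟨l', hl'⟩ := (List.duplicate_iff_sublist.mp h).exists_perm_append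
  rw [← List.nil_append l, coeff_mon_perm f hl' []]
  have := coeff_mon_swap f [] l' (true, n) (true, n)
  simp only [and_self, if_true] at this
  simp only [List.nil_append, List.cons_append] at this ⊢
  linarith

theorem mon_append_replicate (l : List (Bool × ℕ)) (n : ℕ) :
    monSet (l ++ List.replicate n (false, 0)) = monSet l ∧
      monExp (l ++ List.replicate n (false, 0)) = monExp l := by
  have h : ∀ k, (l ++ List.replicate n (false, 0)).getD k (false, 0) =
      l.getD k (false, 0) := by
    intro k
    rcases lt_or_ge k l.length with hk | hk
    · rw [List.getD_append _ _ _ _ hk]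
    · rw [List.getD_append_right _ _ _ _ hk, List.getD_eq_default l _ hk]
      simp [List.getD_eq_getElem?_getD, List.getElem?_replicate]
      split_ifs <;> rfl
  constructor
  · ext k
    rw [mem_monSet, mem_monSet, h]
  · ext k
    rw [monExp_apply, monExp_apply, h]

theorem exists_mon (J : Finset ℕ) (α : ℕ →₀ ℕ) :
    ∃ l, monSet l = J ∧ monExp l = α := by
  obtain ⟨N, hN⟩ : ∃ N, ∀ k, N ≤ k → k ∉ J ∧ α k = 0 := by
    refine ⟨(J ∪ α.support).sup id + 1, fun k hk => ?_⟩
    have h : k ∉ J ∪ α.support := by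
      intro h
      have := Finset.le_sup (f := id) h
      simp only [id] at this
      omega
    rw [Finset.mem_union, not_or, Finsupp.notMem_support_iff] at h
    exact h
  -- From `N` on the default pair `(false, 0)` is the correct entry: the index does not occur.
  have h : ∀ k, ((List.range N).map fun i => (decide (i ∈ J), α i)).getD k (false, 0) =
      (decide (k ∈ J), α k) := by
    intro k
    rcases lt_or_ge k N with hk | hk
    · simp [List.getD_eq_getElem?_getD, hk]
    · rw [List.getD_eq_default _ _ (by simpa using hk)]
      simp [hN k hk]
  refine ⟨(List.range N).map fun i => (decide (i ∈ J), α i), ?_, ?_⟩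
  · ext k
    simp only [mem_monSet, h, decide_eq_true_eq]
  · ext k
    simp only [monExp_apply, h]

/-- The list of pairs with the exponents `a` at the indices in `J`, followed by the
exponents `b` at the indices outside `J`. -/
def monList (a b : List ℕ) : List (Bool × ℕ) :=
  a.map (fun n => (true, n)) ++ b.map (fun n => (false, n))

theorem map_filter_range_getD {A : Type*} (l : List A) (d : A) (P : A → Prop) [DecidablePred P]
    (g : A → ℕ) :
    (((Finset.range l.length).filter fun i => P (l.getD i d)).val.map fun i => g (l.getD i d)) =
      ↑((l.filter P).map g) := by
  have h : (List.range l.length).map (fun i => l.getD i d) = l := by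
    refine List.ext_getElem (by simp) fun i h1 h2 => ?_
    simp [List.getD_eq_getElem?_getD, h2]
  have h' : l.filter P = ((List.range l.length).filter fun i => P (l.getD i d)).map
      fun i => l.getD i d := by
    conv_lhs => rw [← h, List.filter_map]
    rfl
  rw [h', List.map_map]
  rfl

theorem hasType_monList (a b : List ℕ) (hb : ∀ k ∈ b, 0 < k) :
    HasType (monSet (monList a b)) (monExp (monList a b)) a b := by
  constructor
  · have := map_filter_range_getD (monList a b) (false, 0) (fun q => q.1 = true) Prod.snd
    refine Eq.trans this ?_
    simp [monList, List.filter_append, List.filter_map, Function.comp_def]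
  · have := map_filter_range_getD (monList a b) (false, 0)
      (fun q => q.2 ≠ 0 ∧ q.1 = false) Prod.snd
    have e : (monExp (monList a b)).support \ monSet (monList a b) =
        (Finset.range (monList a b).length).filter fun i =>
          ((monList a b).getD i (false, 0)).2 ≠ 0 ∧ ((monList a b).getD i (false, 0)).1 = false := by
      ext k
      rw [Finset.mem_sdiff, Finsupp.mem_support_iff, mem_monSet, monExp_apply, Finset.mem_filter,
        Finset.mem_range, Bool.not_eq_true, iff_and_self]
      intro h
      by_contra h0
      rw [List.getD_eq_default _ _ (not_lt.mp h0)] at h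
      exact h.1 rfl
    rw [e]
    refine Eq.trans this ?_
    have h3 : b.filter (fun k => !decide (k = 0)) = b :=
      List.filter_eq_self.mpr fun k hk => by simpa using (hb k hk).ne'
    simp [monList, List.filter_append, List.filter_map, Function.comp_def, h3]

end SymSuper

/-! ### One coefficient per superpartition determines an element -/

namespace SuperPartition

open SymSuper

theorem exists_hasType (Λ : SuperPartition) : ∃ J α, HasType J α Λ.anti Λ.symm :=
  ⟨_, _, hasType_monList _ _ Λ.symm_pos⟩

/-- The coefficient of a distinguished monomial of type `Λ`. -/
noncomputable def monCoeff (Λ : SuperPartition) : SymSuper →ₗ[ℚ] ℚ :=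
  coeff (monSet (monList Λ.anti Λ.symm)) (monExp (monList Λ.anti Λ.symm))

/-- The degree of `p_Λ`. -/
def size (Λ : SuperPartition) : ℕ := Λ.anti.length + (Λ.anti.sum + Λ.symm.sum)

/-- The pairs `(false, 0)` stand for absent variables and are collected at the end, whereas `(true,
0)` is a genuine part 0. Repetitions in `a` are still allowed. -/
theorem monList_perm (l : List (Bool × ℕ)) : ∃ (a b : List ℕ) (n : ℕ),
    a.Pairwise (· ≥ ·) ∧ b.Pairwise (· ≥ ·) ∧ (∀ k ∈ b, 0 < k) ∧
      l.Perm (monList a b ++ List.replicate n (false, 0)) := by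
  induction l with
  | nil => exact ⟨[], [], 0, by simp [monList]⟩
  | cons q l ih =>
    obtain ⟨a, b, n, h1, h2, h3, h4⟩ := ih
    have h5 := h4.cons q
    match q, h5 with
    | (true, k), h5 =>
      refine ⟨a.orderedInsert (· ≥ ·) k, b, n, h1.orderedInsert k a, h2, h3, h5.trans ?_⟩
      have := ((List.perm_orderedInsert (· ≥ ·) k a).map (fun n => (true, n))).symm
      simp only [monList, List.append_assoc]
      exact this.append_right (b.map (fun n => (false, n)) ++ _)
    | (false, 0), h5 =>
      refine ⟨a, b, n + 1, h1, h2, h3, h5.trans ?_⟩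
      rw [List.replicate_succ]
      exact List.perm_middle.symm
    | (false, k + 1), h5 =>
      refine ⟨a, b.orderedInsert (· ≥ ·) (k + 1), n, h1, h2.orderedInsert _ b, ?_, h5.trans ?_⟩
      · intro i hi
        rw [List.mem_orderedInsert] at hi
        rcases hi with rfl | hi
        · exact Nat.succ_pos k
        · exact h3 i hi
      · have := ((List.perm_orderedInsert (· ≥ ·) (k + 1) b).map (fun n => (false, n))).symm
        simp only [monList, List.append_assoc]
        refine List.perm_middle.symm.trans (List.Perm.append_left _ ?_)
        exact this.append_right _

/-- After sorting, a monomial either repeats a fermionic exponent, so its coefficient vanishes by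
antisymmetry, or is the distinguished monomial of a superpartition. -/
theorem eq_zero_of_monCoeff (f : SymSuper) (h : ∀ Λ : SuperPartition, Λ.monCoeff f = 0) :
    f = 0 := by
  refine ext_coeff fun J α => ?_
  rw [map_zero]
  obtain ⟨l, rfl, rfl⟩ := exists_mon J α
  obtain ⟨a, b, n, h1, h2, h3, h4⟩ := monList_perm l
  by_cases hnd : a.Nodup
  · rw [← List.nil_append l, coeff_mon_perm f h4 [], List.nil_append,
      (mon_append_replicate _ _).1, (mon_append_replicate _ _).2]
    refine h ⟨a, b, ?_, h2, h3⟩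
    exact (h1.and hnd).imp fun hx => lt_of_le_of_ne hx.1 hx.2.symm
  · obtain ⟨k, hk⟩ := List.exists_duplicate_iff_not_nodup.mpr hnd
    rw [← List.nil_append l, coeff_mon_perm f h4 [], List.nil_append]
    refine coeff_mon_eq_zero_of_duplicate f k ?_
    rw [List.duplicate_iff_sublist] at hk ⊢
    rw [monList, List.append_assoc]
    exact (hk.map fun n => (true, n)).trans (List.sublist_append_left _ _)

/-- Both lists have at most `d` entries, each at most `d`; for the symmetric one the length is
bounded by the sum because its parts are positive. -/
theorem finite_size_le (d : ℕ) : {Λ : SuperPartition | Λ.size ≤ d}.Finite := by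
  have hL : {l : List ℕ | l.length ≤ d ∧ ∀ k ∈ l, k ≤ d}.Finite := by
    refine ((List.finite_length_le (Fin (d + 1)) d).image (List.map Fin.val)).subset ?_
    rintro l ⟨h1, h2⟩
    refine ⟨l.pmap (fun k hk => ⟨k, hk⟩) fun k hk => Nat.lt_succ_of_le (h2 k hk), ?_, ?_⟩
    · simpa using h1
    · simp [List.map_pmap]
  refine ((hL.prod hL).preimage (f := fun Λ : SuperPartition => (Λ.anti, Λ.symm)) ?_).subset ?_
  · intro Λ _ Ω _ h
    rw [Prod.mk.injEq] at h
    exact SuperPartition.ext h.1 h.2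
  · intro Λ hΛ
    rw [Set.mem_ofPred_eq, size] at hΛ
    have h1 : Λ.symm.length ≤ Λ.symm.sum := List.length_le_sum_of_one_le _ Λ.symm_pos
    have h2 : ∀ k ∈ Λ.anti, k ≤ Λ.anti.sum := fun k hk => List.single_le_sum (by simp) k hk
    have h3 : ∀ k ∈ Λ.symm, k ≤ Λ.symm.sum := fun k hk => List.single_le_sum (by simp) k hk
    refine ⟨⟨?_, fun k hk => ?_⟩, ⟨?_, fun k hk => ?_⟩⟩
    · simp only; omega
    · have := h2 k hk; omega
    · simp only; omega
    · have := h3 k hk; omega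

end SuperPartition

/-! ### Degree filtration and the power sum basis -/

namespace SymSuper

/-- The symmetric superfunctions of degree at most `d`. -/
def degreeLE (d : ℕ) : Submodule ℚ SymSuper where
  carrier := {f | ∀ (J : Finset ℕ) (α : ℕ →₀ ℕ), d < J.card + α.degree → coeff J α f = 0}
  zero_mem' := fun _ _ _ => map_zero _
  add_mem' := fun hf hg J α h => by rw [map_add, hf J α h, hg J α h, add_zero]
  smul_mem' := fun c f hf J α h => by rw [map_smul, hf J α h, smul_zero]

theorem exists_mem_degreeLE (f : SymSuper) : ∃ d, f ∈ degreeLE d := by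
  obtain ⟨d, hd⟩ := f.2.1
  refine ⟨d, fun J α h => ?_⟩
  by_contra h0
  exact h.not_ge (hd J α h0)

end SymSuper

namespace SuperPartition

open SymSuper

theorem monCoeff_eq_zero {d : ℕ} {f : SymSuper} (hf : f ∈ degreeLE d) {Λ : SuperPartition}
    (h : d < Λ.size) : Λ.monCoeff f = 0 := by
  have hT := hasType_monList Λ.anti Λ.symm Λ.symm_pos
  exact hf _ _ (by rwa [hT.card, hT.degree])

theorem p_mem_degreeLE (Λ : SuperPartition) {d : ℕ} (h : Λ.size ≤ d) : Λ.p ∈ degreeLE d := by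
  intro J α hd
  by_contra h0
  rw [p_eq_powerProd] at h0
  obtain ⟨h1, h2, _⟩ := card_degree_of_coeff_powerProd_ne_zero _ _ Λ.symm_pos J α h0
  rw [size] at h
  omega

/-- The distinguished coefficients embed the space into a coordinate space indexed by the
superpartitions of size at most `d`. The equally many independent `p_Λ` in it must then span. -/
theorem degreeLE_le_span (d : ℕ) : degreeLE d ≤ Submodule.span ℚ (Set.range p) := by
  have hfin : Finite {Λ : SuperPartition // Λ.size ≤ d} := (finite_size_le d).to_subtype
  have := Fintype.ofFinite {Λ : SuperPartition // Λ.size ≤ d}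
  let Φ : degreeLE d →ₗ[ℚ] ({Λ : SuperPartition // Λ.size ≤ d} → ℚ) :=
    LinearMap.pi fun Λ => Λ.1.monCoeff ∘ₗ (degreeLE d).subtype
  have hΦ : Function.Injective Φ := by
    rw [injective_iff_map_eq_zero]
    intro f hf
    apply Subtype.ext
    refine eq_zero_of_monCoeff f.1 fun Λ => ?_
    rcases le_or_gt Λ.size d with h | h
    · exact congrFun hf ⟨Λ, h⟩
    · exact monCoeff_eq_zero f.2 h
  have hfd : FiniteDimensional ℚ (degreeLE d) := FiniteDimensional.of_injective Φ hΦ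
  have hle : Module.finrank ℚ (degreeLE d) ≤ Fintype.card {Λ : SuperPartition // Λ.size ≤ d} := by
    have := LinearMap.finrank_le_finrank_of_injective hΦ
    rwa [Module.finrank_fintype_fun_eq_card] at this
  let v : {Λ : SuperPartition // Λ.size ≤ d} → degreeLE d :=
    fun Λ => ⟨Λ.1.p, Λ.1.p_mem_degreeLE Λ.2⟩
  have hv : LinearIndependent ℚ v := by
    refine LinearIndependent.of_comp (degreeLE d).subtype ?_
    exact (linearIndependent_p exists_hasType).comp _ Subtype.val_injective
  have hspan := hv.span_eq_top_of_card_eq_finrank' (le_antisymm hv.fintype_card_le_finrank hle)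
  intro f hf
  have h : (⟨f, hf⟩ : degreeLE d) ∈ Submodule.span ℚ (Set.range v) := hspan ▸ Submodule.mem_top
  have h' := Submodule.mem_map_of_mem (f := (degreeLE d).subtype) h
  rw [Submodule.map_span] at h'
  refine Submodule.span_mono ?_ h'
  rintro _ ⟨_, ⟨Λ, rfl⟩, rfl⟩
  exact ⟨Λ.1, rfl⟩

/-- The products of power sums form a basis. -/
noncomputable def basis : Module.Basis SuperPartition ℚ SymSuper :=
  Module.Basis.mk (linearIndependent_p exists_hasType) fun f _ => by
    obtain ⟨d, hd⟩ := exists_mem_degreeLE f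
    exact degreeLE_le_span d hd

theorem basis_apply (Λ : SuperPartition) : basis Λ = Λ.p := Module.Basis.mk_apply _ _ _

/-- The sign `(-1) ^ (m (m - 1) / 2)` for `m` fermionic parts. -/
def revSign (Λ : SuperPartition) : ℚ := (-1) ^ (Λ.anti.length * (Λ.anti.length - 1) / 2)

theorem revSign_mul_self (Λ : SuperPartition) : Λ.revSign * Λ.revSign = 1 := by
  rw [revSign, ← mul_pow]
  simp

/-- All monomials of `p_Λ` contain the same number of `θ`'s, one for each fermionic part. -/
theorem reverse_p (Λ : SuperPartition) : reverse Λ.p = Λ.revSign • Λ.p := by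
  refine ext_coeff fun J α => ?_
  have h : coeff J α (reverse Λ.p) =
      (-1) ^ (J.card * (J.card - 1) / 2) * coeff J α Λ.p := by
    have h1 : (reverse Λ.p).1 J = (-1) ^ (J.card * (J.card - 1) / 2) * Λ.p.1 J := rfl
    rw [coeff_apply, h1, coeff_apply]
    rcases Nat.even_or_odd (J.card * (J.card - 1) / 2) with h | h <;> simp [h.neg_one_pow]
  rw [h, map_smul, smul_eq_mul, revSign]
  by_cases h0 : coeff J α Λ.p = 0
  · rw [h0, mul_zero, mul_zero]
  · rw [p_eq_powerProd] at h0
    rw [(card_degree_of_coeff_powerProd_ne_zero _ _ Λ.symm_pos J α h0).1]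

end SuperPartition

/-! ### The involution -/

namespace SymSuper

theorem powerProd_perm_right (a : List ℕ) {b b' : List ℕ} (h : b.Perm b') :
    powerProd a b = powerProd a b' := by
  unfold powerProd
  rw [(h.map p).prod_eq']
  rw [List.pairwise_map]
  exact List.pairwise_of_forall fun _ _ => commute_p _ _

theorem prod_pTilde_perm {a a' : List ℕ} (h : a.Perm a') :
    (a.map pTilde).prod = (a'.map pTilde).prod ∨ (a.map pTilde).prod = -(a'.map pTilde).prod := by
  induction h with
  | nil => exact Or.inl rfl
  | cons n _ ih =>
    simp only [List.map_cons, List.prod_cons]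
    rcases ih with ih | ih
    · exact Or.inl (by rw [ih])
    · exact Or.inr (by rw [ih, mul_neg])
  | swap m n l =>
    refine Or.inr ?_
    simp only [List.map_cons, List.prod_cons]
    rw [← mul_assoc, pTilde_mul_pTilde, neg_mul, mul_assoc]
  | trans _ _ ih1 ih2 =>
    rcases ih1 with h1 | h1 <;> rcases ih2 with h2 | h2 <;> simp [h1, h2]

theorem powerProd_perm_left {a a' : List ℕ} (h : a.Perm a') (b : List ℕ) :
    powerProd a b = powerProd a' b ∨ powerProd a b = -powerProd a' b := by
  unfold powerProd
  rcases prod_pTilde_perm h with h | h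
  · exact Or.inl (by rw [h])
  · exact Or.inr (by rw [h, mul_neg])

theorem pTilde_mul_self (n : ℕ) : pTilde n * pTilde n = 0 := by
  have h := pTilde_mul_pTilde n n
  rw [eq_neg_iff_add_eq_zero, ← two_smul ℚ] at h
  exact (smul_eq_zero.mp h).resolve_left two_ne_zero

theorem powerProd_eq_zero {a : List ℕ} (h : ¬ a.Nodup) (b : List ℕ) : powerProd a b = 0 := by
  obtain ⟨k, hk⟩ := List.exists_duplicate_iff_not_nodup.mpr h
  obtain ⟨a', ha'⟩ := (List.duplicate_iff_sublist.mp hk).exists_perm_append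
  have h0 : powerProd ([k, k] ++ a') b = 0 := by
    simp only [powerProd, List.cons_append, List.nil_append, List.map_cons, List.prod_cons]
    rw [← mul_assoc (pTilde k), pTilde_mul_self, zero_mul, mul_zero]
  rcases powerProd_perm_left ha' b with h | h <;> rw [h, h0]
  exact neg_zero

theorem powerProd_mul (a b a' b' : List ℕ) :
    powerProd a b * powerProd a' b' = powerProd (a ++ a') (b ++ b') := by
  unfold powerProd
  simp only [List.map_append, List.prod_append]
  rw [mul_assoc, mul_assoc, (commute_prod_p b' _).symm.left_comm]

/-- The sign by which the involution multiplies a product of power sums. -/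
def omegaSign (a b : List ℕ) : ℚ :=
  (a.map fun n => (-1 : ℚ) ^ n).prod * (b.map fun n => (-1 : ℚ) ^ (n + 1)).prod

theorem omegaSign_append (a b a' b' : List ℕ) :
    omegaSign (a ++ a') (b ++ b') = omegaSign a b * omegaSign a' b' := by
  simp only [omegaSign, List.map_append, List.prod_append]
  ring

theorem prod_neg_one_pow_mul_self (l : List ℕ) (g : ℕ → ℕ) :
    (l.map fun n => (-1 : ℚ) ^ g n).prod * (l.map fun n => (-1 : ℚ) ^ g n).prod = 1 := by
  rw [← List.prod_map_mul]
  refine List.prod_eq_one fun x hx => ?_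
  obtain ⟨n, _, rfl⟩ := List.mem_map.mp hx
  rw [← mul_pow]
  simp

theorem omegaSign_mul_self (a b : List ℕ) : omegaSign a b * omegaSign a b = 1 := by
  rw [omegaSign, mul_mul_mul_comm, prod_neg_one_pow_mul_self, prod_neg_one_pow_mul_self, one_mul]

/-- The involution as a linear map. -/
noncomputable def omegaLinear : SymSuper →ₗ[ℚ] SymSuper :=
  SuperPartition.basis.constr ℚ fun Λ => omegaSign Λ.anti Λ.symm • Λ.p

theorem omegaLinear_p (Λ : SuperPartition) :
    omegaLinear Λ.p = omegaSign Λ.anti Λ.symm • Λ.p := by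
  rw [omegaLinear, ← SuperPartition.basis_apply, Module.Basis.constr_basis,
    SuperPartition.basis_apply]

/-- Sorting changes the product at most by a sign and leaves `omegaSign` unchanged; with a repeated
fermionic index both sides are 0. Unsorted lists are needed because a product of two basis elements
concatenates their lists. -/
theorem omegaLinear_powerProd (a b : List ℕ) (hb : ∀ k ∈ b, 0 < k) :
    omegaLinear (powerProd a b) = omegaSign a b • powerProd a b := by
  by_cases ha : a.Nodup
  · have pa := List.perm_insertionSort (· ≥ ·) a
    have pb := List.perm_insertionSort (· ≥ ·) b
    have hs : omegaSign (a.insertionSort (· ≥ ·)) (b.insertionSort (· ≥ ·)) = omegaSign a b := by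
      rw [omegaSign, (pa.map _).prod_eq, (pb.map _).prod_eq, omegaSign]
    have h := omegaLinear_p ⟨a.insertionSort (· ≥ ·), b.insertionSort (· ≥ ·),
      ((List.pairwise_insertionSort (· ≥ ·) a).and (pa.nodup_iff.mpr ha)).imp
        fun hx => lt_of_le_of_ne hx.1 hx.2.symm,
      List.pairwise_insertionSort (· ≥ ·) b, fun k hk => hb k (pb.mem_iff.mp hk)⟩
    rw [SuperPartition.p_eq_powerProd] at h
    simp only [hs, powerProd_perm_right _ pb] at h
    rcases powerProd_perm_left pa b with h' | h' <;> rw [h'] at h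
    · exact h
    · rwa [map_neg, smul_neg, neg_inj] at h
  · rw [powerProd_eq_zero ha, map_zero, smul_zero]

/-- By bilinearity basis elements suffice, and there the sign is multiplicative under concatenation.
-/
theorem omegaLinear_mul (f g : SymSuper) :
    omegaLinear (f * g) = omegaLinear f * omegaLinear g := by
  have h : (LinearMap.mul ℚ SymSuper).compr₂ omegaLinear =
      (LinearMap.mul ℚ SymSuper).compl₁₂ omegaLinear omegaLinear := by
    refine SuperPartition.basis.ext fun Λ => SuperPartition.basis.ext fun Ω => ?_
    have hpos : ∀ k ∈ Λ.symm ++ Ω.symm, 0 < k := fun k hk =>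
      (List.mem_append.mp hk).elim (Λ.symm_pos k) (Ω.symm_pos k)
    simp only [SuperPartition.basis_apply, LinearMap.compr₂_apply, LinearMap.compl₁₂_apply,
      LinearMap.mul_apply', omegaLinear_p]
    simp only [SuperPartition.p_eq_powerProd, smul_mul_smul_comm, powerProd_mul]
    rw [omegaLinear_powerProd _ _ hpos, omegaSign_append]
  exact congrArg (fun φ => φ f g) h

/-- The involution that sends elementary to complete functions. -/
noncomputable def omega : SymSuper →ₐ[ℚ] SymSuper :=
  AlgHom.ofLinearMap omegaLinear
    (by simpa [powerProd, omegaSign] using omegaLinear_powerProd [] [] (by simp))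
    omegaLinear_mul

theorem omega_apply (f : SymSuper) : omega f = omegaLinear f := rfl

theorem omega_p_succ (n : ℕ) : omega (p (n + 1)) = (-1 : ℚ) ^ n • p (n + 1) := by
  simpa [powerProd, omegaSign, pow_succ, omega_apply] using omegaLinear_powerProd [] [n + 1] (by simp)

theorem omega_pTilde (n : ℕ) : omega (pTilde n) = (-1 : ℚ) ^ n • pTilde n := by
  simpa [powerProd, omegaSign, omega_apply] using omegaLinear_powerProd [n] [] (by simp)

theorem neg_one_pow_smul_smul (n : ℕ) (f : SymSuper) :
    (-1 : ℚ) ^ n • (-1 : ℚ) ^ n • f = f := by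
  rw [smul_smul, ← mul_pow]
  simp

/-- The signs of the map on power sums cancel those in the recursion for `e`, leaving the recursion
for `h`; the factor `n + 1` is invertible over `ℚ`. -/
theorem omega_e (n : ℕ) : omega (e n) = h n := by
  induction n using Nat.strong_induction_on with
  | _ n ih =>
    cases n with
    | zero => rw [e_zero, h_zero, map_one]
    | succ n =>
      have h1 : ((n : ℚ) + 1) • omega (e (n + 1)) = ((n : ℚ) + 1) • h (n + 1) := by
        rw [← map_smul, succ_smul_e, succ_smul_h, map_sum]
        refine Finset.sum_congr rfl fun i _ => ?_
        rw [map_smul, map_mul, omega_p_succ, ih (n - i) (by omega), smul_mul_assoc,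
          neg_one_pow_smul_smul]
      exact smul_right_injective _ (by positivity : (n : ℚ) + 1 ≠ 0) h1

theorem omega_eTilde (n : ℕ) : omega (eTilde n) = hTilde n := by
  rw [eTilde_eq, hTilde_eq, map_sum]
  refine Finset.sum_congr rfl fun i _ => ?_
  rw [map_smul, map_mul, omega_pTilde, omega_e, smul_mul_assoc, neg_one_pow_smul_smul]

theorem isOmega_omega : IsOmega omega := fun n => ⟨omega_e n, omega_eTilde n⟩

/-- The Newton identity is solved for its last term, which is `±p (n + 1)` because `e 0 = 1`; the
earlier terms match by induction. -/
theorem isOmega_p_succ {ω : SymSuper →ₐ[ℚ] SymSuper} (hω : IsOmega ω) (n : ℕ) :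
    ω (p (n + 1)) = (-1 : ℚ) ^ n • p (n + 1) := by
  induction n using Nat.strong_induction_on with
  | _ n ih =>
    have h1 := congrArg ω (succ_smul_e n)
    rw [map_smul, (hω _).1, succ_smul_h, map_sum, Finset.sum_range_succ, Finset.sum_range_succ,
      Nat.sub_self, e_zero, h_zero, mul_one, map_smul] at h1
    have h2 : ∑ i ∈ Finset.range n, p (i + 1) * h (n - i) =
        ∑ i ∈ Finset.range n, ω ((-1 : ℚ) ^ i • (p (i + 1) * e (n - i))) := by
      refine Finset.sum_congr rfl fun i hi => ?_
      rw [map_smul, map_mul, ih i (Finset.mem_range.mp hi), (hω _).1, smul_mul_assoc,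
        neg_one_pow_smul_smul]
    rw [h2, add_right_inj] at h1
    conv_rhs => rw [h1, neg_one_pow_smul_smul]

theorem isOmega_pTilde {ω : SymSuper →ₐ[ℚ] SymSuper} (hω : IsOmega ω) (n : ℕ) :
    ω (pTilde n) = (-1 : ℚ) ^ n • pTilde n := by
  induction n using Nat.strong_induction_on with
  | _ n ih =>
    have h1 := congrArg ω (eTilde_eq n)
    rw [(hω _).2, hTilde_eq, map_sum, Finset.sum_range_succ, Finset.sum_range_succ,
      Nat.sub_self, e_zero, h_zero, mul_one, map_smul] at h1
    have h2 : ∑ i ∈ Finset.range n, pTilde i * h (n - i) =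
        ∑ i ∈ Finset.range n, ω ((-1 : ℚ) ^ i • (pTilde i * e (n - i))) := by
      refine Finset.sum_congr rfl fun i hi => ?_
      rw [map_smul, map_mul, ih i (Finset.mem_range.mp hi), (hω _).1, smul_mul_assoc,
        neg_one_pow_smul_smul]
    rw [h2, add_right_inj] at h1
    conv_rhs => rw [h1, neg_one_pow_smul_smul]

/-- The values on `e` and `eTilde` force those on the power sums, whose products span. -/
theorem eq_omega_of_isOmega {ω : SymSuper →ₐ[ℚ] SymSuper} (hω : IsOmega ω) : ω = omega := by
  have h : ω.toLinearMap = omega.toLinearMap := by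
    refine SuperPartition.basis.ext fun Λ => ?_
    rw [SuperPartition.basis_apply, AlgHom.toLinearMap_apply, AlgHom.toLinearMap_apply,
      SuperPartition.p]
    simp only [map_mul, map_list_prod, List.map_map]
    congr 2
    · refine List.map_congr_left fun n _ => ?_
      rw [Function.comp_apply, Function.comp_apply, isOmega_pTilde hω, omega_pTilde]
    · refine List.map_congr_left fun n hn => ?_
      obtain ⟨k, rfl⟩ := Nat.exists_eq_add_of_lt (Λ.symm_pos n hn)
      rw [Function.comp_apply, Function.comp_apply, isOmega_p_succ hω, omega_p_succ]
  exact AlgHom.toLinearMap_injective h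

theorem omega_omega (f : SymSuper) : omega (omega f) = f := by
  have h : omegaLinear ∘ₗ omegaLinear = LinearMap.id := by
    refine SuperPartition.basis.ext fun Λ => ?_
    rw [SuperPartition.basis_apply, LinearMap.comp_apply, omegaLinear_p, map_smul, omegaLinear_p,
      smul_smul, omegaSign_mul_self, one_smul, LinearMap.id_apply]
  exact congrArg (fun φ => φ f) h

/-! ### The bilinear form -/

/-- The bilinear form for which the reversed products of power sums are dual to the products of
power sums up to the factors `z_Λ`. -/
noncomputable def form : LinearMap.BilinForm ℚ SymSuper :=
  SuperPartition.basis.constr ℚ fun Λ => (Λ.revSign * Λ.z) • SuperPartition.basis.coord Λ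

theorem form_p (Λ : SuperPartition) :
    form Λ.p = (Λ.revSign * Λ.z) • SuperPartition.basis.coord Λ := by
  rw [form, ← SuperPartition.basis_apply, Module.Basis.constr_basis]

open Classical in
theorem coord_p (Λ Ω : SuperPartition) :
    SuperPartition.basis.coord Λ Ω.p = if Λ = Ω then 1 else 0 := by
  rw [← SuperPartition.basis_apply, Module.Basis.coord_apply, Module.Basis.repr_self,
    Finsupp.single_apply]
  exact if_congr eq_comm rfl rfl

/-- The sign of the reversal and the sign built into `form` cancel. -/
theorem form_reverse_p (Λ : SuperPartition) :
    form (reverse Λ.p) = (Λ.z : ℚ) • SuperPartition.basis.coord Λ := by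
  rw [SuperPartition.reverse_p, map_smul, form_p, smul_smul, ← mul_assoc,
    SuperPartition.revSign_mul_self, one_mul]

theorem isPowerSumForm_form : IsPowerSumForm form := by
  classical
  intro Λ Ω
  rw [form_reverse_p, LinearMap.smul_apply, coord_p, smul_eq_mul, mul_ite, mul_one, mul_zero]

theorem reverse_reverse (f : SymSuper) : reverse (reverse f) = f := by
  have h : reverse ∘ₗ reverse = LinearMap.id := by
    refine SuperPartition.basis.ext fun Λ => ?_
    rw [SuperPartition.basis_apply, LinearMap.comp_apply, SuperPartition.reverse_p, map_smul,
      SuperPartition.reverse_p, smul_smul, SuperPartition.revSign_mul_self, one_smul,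
      LinearMap.id_apply]
  exact congrArg (fun φ => φ f) h

/-- The condition fixes the form with its first argument reversed, and reversal is bijective. -/
theorem eq_of_isPowerSumForm {B B' : LinearMap.BilinForm ℚ SymSuper} (hB : IsPowerSumForm B)
    (hB' : IsPowerSumForm B') : B' = B := by
  have h : B' ∘ₗ reverse = B ∘ₗ reverse :=
    SuperPartition.basis.ext fun Λ => SuperPartition.basis.ext fun Ω => by
      simp only [SuperPartition.basis_apply, LinearMap.comp_apply]
      rw [hB, hB']
  refine LinearMap.ext fun f => ?_
  have := congrArg (fun φ => φ (reverse f)) h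
  simpa only [LinearMap.comp_apply, reverse_reverse] using this

theorem form_symm (f g : SymSuper) : form f g = form g f := by
  classical
  have h : form = LinearMap.flip form := by
    refine SuperPartition.basis.ext fun Λ => SuperPartition.basis.ext fun Ω => ?_
    rw [LinearMap.flip_apply, SuperPartition.basis_apply, SuperPartition.basis_apply, form_p,
      form_p, LinearMap.smul_apply, LinearMap.smul_apply, coord_p, coord_p]
    by_cases h : Λ = Ω
    · rw [h]
    · rw [if_neg h, if_neg (Ne.symm h), smul_zero, smul_zero]
  exact congrArg (fun φ => φ f g) h

theorem form_reverse_symm (f g : SymSuper) : form (reverse f) g = form (reverse g) f := by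
  classical
  have h : form ∘ₗ reverse = LinearMap.flip (form ∘ₗ reverse) := by
    refine SuperPartition.basis.ext fun Λ => SuperPartition.basis.ext fun Ω => ?_
    rw [LinearMap.flip_apply, SuperPartition.basis_apply, SuperPartition.basis_apply,
      LinearMap.comp_apply, LinearMap.comp_apply, isPowerSumForm_form, isPowerSumForm_form]
    by_cases h : Λ = Ω
    · rw [h]
    · rw [if_neg h, if_neg (Ne.symm h)]
  exact congrArg (fun φ => φ f g) h

/-- Off the diagonal both sides vanish; on it the sign of the involution appears twice. -/
theorem form_reverse_omega (f g : SymSuper) :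
    form (reverse (omega f)) (omega g) = form (reverse f) g := by
  classical
  have h : (form ∘ₗ reverse).compl₁₂ omegaLinear omegaLinear = form ∘ₗ reverse := by
    refine SuperPartition.basis.ext fun Λ => SuperPartition.basis.ext fun Ω => ?_
    rw [LinearMap.compl₁₂_apply, SuperPartition.basis_apply, SuperPartition.basis_apply,
      LinearMap.comp_apply, LinearMap.comp_apply, omegaLinear_p, omegaLinear_p, map_smul, map_smul,
      map_smul, LinearMap.smul_apply, isPowerSumForm_form]
    by_cases h : Λ = Ω
    · rw [h, smul_smul, omegaSign_mul_self, one_smul]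
    · rw [if_neg h, smul_zero, smul_zero]
  exact congrArg (fun φ => φ f g) h

/-- In coordinates `c_Λ` the value is the sum of the `z_Λ c_Λ^2`, and `z_Λ` is positive because the
parts of `Λ.symm` are. -/
theorem form_reverse_self_pos {f : SymSuper} (hf : f ≠ 0) : 0 < form (reverse f) f := by
  have h : form ∘ₗ reverse = SuperPartition.basis.constr ℚ
      fun Λ => (Λ.z : ℚ) • SuperPartition.basis.coord Λ := by
    refine SuperPartition.basis.ext fun Λ => ?_
    rw [Module.Basis.constr_basis, SuperPartition.basis_apply, LinearMap.comp_apply,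
      form_reverse_p]
  have h' : form (reverse f) f =
      ∑ Λ ∈ (SuperPartition.basis.repr f).support,
        SuperPartition.basis.repr f Λ * (Λ.z * SuperPartition.basis.repr f Λ) := by
    rw [← LinearMap.comp_apply, h, Module.Basis.constr_apply, Finsupp.sum, LinearMap.sum_apply]
    rfl
  rw [h']
  refine Finset.sum_pos (fun Λ hΛ => ?_) ?_
  · have hz : 0 < Λ.z := Finset.prod_pos fun k hk =>
      Nat.mul_pos (pow_pos (Λ.symm_pos k (List.mem_toFinset.mp hk)) _) (Nat.factorial_pos _)
    have hz' : (0 : ℚ) < Λ.z := Nat.cast_pos.mpr hz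
    rw [mul_left_comm]
    exact mul_pos hz' (mul_self_pos.mpr (Finsupp.mem_support_iff.mp hΛ))
  · rw [Finsupp.support_nonempty_iff]
    exact fun h0 => hf (SuperPartition.basis.repr.map_eq_zero_iff.mp h0)

end SymSuper

theorem mainTheorem8 :
    ∃ B : LinearMap.BilinForm ℚ SymSuper, ∃ ω : SymSuper →ₐ[ℚ] SymSuper,
      (IsPowerSumForm B ∧ ∀ B' : LinearMap.BilinForm ℚ SymSuper, IsPowerSumForm B' → B' = B) ∧
      (IsOmega ω ∧ ∀ ω' : SymSuper →ₐ[ℚ] SymSuper, IsOmega ω' → ω' = ω) ∧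
      (∀ f g : SymSuper,
        B (SymSuper.reverse f) g = B (SymSuper.reverse g) f ∧
        B (SymSuper.reverse f) g = B g (SymSuper.reverse f)) ∧
      (∀ f : SymSuper, f ≠ 0 → 0 < B (SymSuper.reverse f) f) ∧
      (∀ f : SymSuper, ω (ω f) = f) ∧
      (∀ f g : SymSuper,
        B (SymSuper.reverse (ω f)) (ω g) = B (SymSuper.reverse f) g) :=
  ⟨SymSuper.form, SymSuper.omega,
    ⟨SymSuper.isPowerSumForm_form, fun _ => SymSuper.eq_of_isPowerSumForm
      SymSuper.isPowerSumForm_form⟩,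
    ⟨SymSuper.isOmega_omega, fun _ => SymSuper.eq_omega_of_isOmega⟩,
    fun f g => ⟨SymSuper.form_reverse_symm f g, SymSuper.form_symm _ _⟩,
    fun _ => SymSuper.form_reverse_self_pos,
    SymSuper.omega_omega, SymSuper.form_reverse_omega⟩
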